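/- Let $k \le n$ be positive integers, write $[k]=\{1,\dots,k\}$, let $\mathbb P^{k-1}$ be the variety of lines in $\mathbb C^k$, and let $X_{n,k}\subseteq(\mathbb P^{k-1})^n$ be the set of tuples $(\ell_1,\dots,\ell_n)$ with $\ell_1+\cdots+\ell_n=\mathbb C^k$. For a word $w=[w(1),\dots,w(n)]\in[k]^n$, call a position $j$ initial if $w(j')\neq w(j)$ for all $j'<j$. The pattern matrix $\mathrm{PM}(w)$ is the $k\times n$ matrix with entries in $\{0,1,*\}$ in which $\mathrm{PM}(w)_{w(j),j}=1$ for all $j$; if $j$ is initial, $\mathrm{PM}(w)_{i,j}=*$ for all $i<w(j)$ such that $w(j')=i$ for some $j'<j$; if $j$ is not initial, $\mathrm{PM}(w)_{i,j}=*$ for all letters $i$ of $w$ whose first occurrence in $w$ is before the first occurrence of the letter $w(j)$; and all other entries are $0$. A complex $k\times n$ matrix fits the pattern of $w$ if it is obtained from $\mathrm{PM}(w)$ by replacing the $*$'s with complex numbers. Let $U_k(w)$ be the group of lower triangular complex $k\times k$ matrices $u$ with $1$'s on the diagonal and $u_{i,j}=0$ for $i>j$ whenever $j$ is not a letter of $w$;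 it is an affine subspace of the space of matrices. Let $\mathring X_w\subseteq(\mathbb P^{k-1})^n$ be the set of tuples of lines spanned by the columns of the matrices $uBt$, where $u\in U_k(w)$, $B$ fits the pattern of $w$, and $t$ is an invertible diagonal $n\times n$ matrix. Let $\mathcal W_{n,k}$ be the set of Fubini words of length $n$ with maximum letter $k$, that is, the words $w\in[k]^n$ in which $k$ occurs and in which $i-1$ occurs whenever $i>1$ occurs. Then: 1. For every $w\in[k]^n$, the subset $\mathring X_w$ of $(\mathbb P^{k-1})^n$ is a locally closed subvariety isomorphic to an affine space, of dimension equal to the number of $*$'s in $\mathrm{PM}(w)$ plus $\dim U_k(w)$. 2. There are set-theoretic disjoint unions $$(\mathbb P^{k-1})^n=\bigsqcup_{w\in[k]^n}\mathring X_w\qquad\text{and}\qquad X_{n,k}=\bigsqcup_{w\in\mathcal W_{n,k}}\mathring X_w.$$ 3. The sets $\mathring X_w$, $w\in[k]^n$, are the cells of an affine paving of $(\mathbb P^{k-1})^n$: there is a chain $\varnothing=Z_0\subsetneq Z_1\subsetneq\cdots\subsetneq Z_m=(\mathbb P^{k-1})^n$ of Zariski closed subsets such that each $\mathring X_w$ is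 contained in one of the differences $Z_i\setminus Z_{i-1}$ and each difference $Z_i\setminus Z_{i-1}$ is, as a variety, the disjoint union of the $\mathring X_w$ contained in it (so that each of these is open in $Z_i\setminus Z_{i-1}$). The chain can be chosen such that $X_{n,k}=(\mathbb P^{k-1})^n\setminus Z_i$ for some $i$. -/

import Mathlib

namespace LineConfig

/-! ### Affine space as a classical variety -/

/-- Complex affine space of dimension `d` (the set of closed points). -/
def AffSpace (d : ℕ) : Type := Fin d → ℂ

/-- The Zariski topology on affine space: the sets where a polynomial does not vanish form a
basis of open sets. -/
instance (d : ℕ) : TopologicalSpace (AffSpace d) :=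
  TopologicalSpace.generateFrom
    {D | ∃ P : MvPolynomial (Fin d) ℂ, D = {x : AffSpace d | MvPolynomial.eval x P ≠ 0}}

/-- `f` is a regular function on the open set `U` of affine space: near every point of `U` it is
a quotient of two polynomials. -/
def AffSpace.IsRegularOn {d : ℕ} (U : Set (AffSpace d)) (f : AffSpace d → ℂ) : Prop :=
  ∀ x ∈ U, ∃ V : Set (AffSpace d), IsOpen V ∧ x ∈ V ∧ V ⊆ U ∧
    ∃ P Q : MvPolynomial (Fin d) ℂ, ∀ y ∈ V,
      MvPolynomial.eval y Q ≠ 0 ∧ f y = MvPolynomial.eval y P / MvPolynomial.eval y Q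

/-! ### The product of projective spaces as a classical variety -/

/-- The product `(ℙ^{k-1})^n`: the set of `n`-tuples of lines in `ℂ^k`. -/
def ProjProd (k n : ℕ) : Type := Fin n → Projectivization ℂ (Fin k → ℂ)

/-- A polynomial in the entries of a `k × n` matrix which is homogeneous of degree `d j` in the
entries of the `j`-th column, for each `j`. -/
def IsMultihomogeneous {k n : ℕ} (P : MvPolynomial (Fin k × Fin n) ℂ) (d : Fin n → ℕ) : Prop :=
  MvPolynomial.IsWeightedHomogeneous
    (fun ij : Fin k × Fin n => (Pi.single ij.2 1 : Fin n → ℕ)) P d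

/-- The value of a polynomial at a matrix whose `j`-th column spans the `j`-th line of `p`. For a
multihomogeneous polynomial its vanishing does not depend on the choice of the matrix, and neither
does the quotient of the values of two polynomials of the same multidegree. -/
noncomputable def ProjProd.eval {k n : ℕ} (p : ProjProd k n)
    (P : MvPolynomial (Fin k × Fin n) ℂ) : ℂ :=
  MvPolynomial.eval (fun ij : Fin k × Fin n => (p ij.2).rep ij.1) P

/-- The Zariski topology on `(ℙ^{k-1})^n`: the sets where a multihomogeneous polynomial does not
vanish form a basis of open sets. -/
instance (k n : ℕ) : TopologicalSpace (ProjProd k n) :=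
  TopologicalSpace.generateFrom
    {D | ∃ (P : MvPolynomial (Fin k × Fin n) ℂ) (d : Fin n → ℕ),
      IsMultihomogeneous P d ∧ D = {p : ProjProd k n | p.eval P ≠ 0}}

/-- `f` is a regular function on the open subset `U` of the (locally closed) subvariety `Y` of
`(ℙ^{k-1})^n`: near every point of `U` it is a quotient of two multihomogeneous polynomials of the
same multidegree. -/
def ProjProd.IsRegularOn {k n : ℕ} {Y : Set (ProjProd k n)} (U : Set Y) (f : Y → ℂ) : Prop :=
  ∀ x ∈ U, ∃ V : Set Y, IsOpen V ∧ x ∈ V ∧ V ⊆ U ∧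
    ∃ (P Q : MvPolynomial (Fin k × Fin n) ℂ) (d : Fin n → ℕ),
      IsMultihomogeneous P d ∧ IsMultihomogeneous Q d ∧
      ∀ y ∈ V, y.1.eval Q ≠ 0 ∧ f y = y.1.eval P / y.1.eval Q

/-- `Y` is a locally closed subvariety of `(ℙ^{k-1})^n` isomorphic, as a variety, to the affine
space of dimension `d`: there is a homeomorphism for the Zariski topologies that identifies the
regular functions on corresponding open sets. -/
def IsAffineSpaceOfDim {k n : ℕ} (Y : Set (ProjProd k n)) (d : ℕ) : Prop :=
  IsLocallyClosed Y ∧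
  ∃ e : Y ≃ₜ AffSpace d, ∀ U : Set (AffSpace d), IsOpen U → ∀ f : AffSpace d → ℂ,
    AffSpace.IsRegularOn U f ↔ ProjProd.IsRegularOn (e ⁻¹' U) (f ∘ e)

/-! ### Disjoint unions and affine pavings -/

/-- `Y` is the disjoint union of the sets `C a` with `a ∈ s`. -/
def IsDisjointUnion {ι X : Type*} (s : Set ι) (C : ι → Set X) (Y : Set X) : Prop :=
  s.PairwiseDisjoint C ∧ ⋃ a ∈ s, C a = Y

/-- The filtration `∅ = Z 0 ⊂ Z 1 ⊂ ⋯ ⊂ Z m = (ℙ^{k-1})^n` by Zariski closed sets is an affine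
paving with the family of cells `C`: every cell belongs to one of the differences
`Z (i + 1) \ Z i`, and each difference is, as a variety, the disjoint union of its cells (so that
these are open in it), each of which is isomorphic to an affine space. -/
structure IsAffinePaving {ι : Type*} {k n m : ℕ} (C : ι → Set (ProjProd k n))
    (Z : Fin (m + 1) → Set (ProjProd k n)) : Prop where
  isClosed : ∀ i, IsClosed (Z i)
  strictMono : StrictMono Z
  zero : Z 0 = ∅
  last : Z (Fin.last m) = Set.univ
  cells : ∃ level : ι → Fin m, ∀ i : Fin m,
    IsDisjointUnion {a | level a = i} C (Z i.succ \ Z i.castSucc) ∧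
    ∀ a, level a = i →
      (∃ O : Set (ProjProd k n), IsOpen O ∧ C a = O ∩ (Z i.succ \ Z i.castSucc)) ∧
      ∃ d : ℕ, IsAffineSpaceOfDim (C a) d

/-! ### Spanning line configurations -/

/-- The variety `X_{n,k}` of `n`-tuples of lines with `ℓ₁ + ⋯ + ℓₙ = ℂ^k`. -/
def spanningConfigs (k n : ℕ) : Set (ProjProd k n) :=
  {p | ⨆ j, (p j).submodule = ⊤}

/-- The tuple of lines spanned by the columns of a matrix without zero columns. -/
noncomputable def ofMatrix {k n : ℕ} (A : Matrix (Fin k) (Fin n) ℂ) (hA : ∀ j, A.col j ≠ 0) : ProjProd k n :=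
  fun j => Projectivization.mk ℂ (A.col j) (hA j)

/-! ### Words and pattern matrices

A word `w ∈ [k]^n` is a function `Fin n → Fin k`; letters and positions are numbered from `0`. -/

/-- `w` is a Fubini word with maximum letter `k`: the predecessor of each letter of `w` that is not
the smallest one is a letter of `w`, and the letter `k` (that is, `k - 1` in `Fin k`) occurs. -/
def IsFubini {k n : ℕ} (w : Fin n → Fin k) : Prop :=
  (∀ a b : Fin k, a.val + 1 = b.val → b ∈ Set.range w → a ∈ Set.range w) ∧
  ∃ j, (w j).val + 1 = k

/-- The position `j` holds the first occurrence of its letter in `w`. -/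
def IsInitial {k n : ℕ} (w : Fin n → Fin k) (j : Fin n) : Prop :=
  ∀ j' < j, w j' ≠ w j

/-- The symbols `0`, `1`, `*`. -/
inductive PatternEntry
  | zero
  | one
  | star

/-- The positions `(i, j)` of the stars. If `j` is initial: those north of the `1` in column `j` and
east of a `1` in row `i`. If `j` is not initial: those for which the initial `1` of row `i` exists
and stands to the west of the initial `1` of row `w j`. -/
def IsStar {k n : ℕ} (w : Fin n → Fin k) (i : Fin k) (j : Fin n) : Prop :=
  (IsInitial w j ∧ i < w j ∧ ∃ j' < j, w j' = i) ∨
  (¬ IsInitial w j ∧ ∃ j₁ j₂ : Fin n, j₁ < j₂ ∧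
    IsInitial w j₁ ∧ w j₁ = i ∧ IsInitial w j₂ ∧ w j₂ = w j)

open Classical in
/-- The pattern matrix of a word. -/
noncomputable def patternMatrix {k n : ℕ} (w : Fin n → Fin k) :
    Matrix (Fin k) (Fin n) PatternEntry :=
  fun i j => if i = w j then .one else if IsStar w i j then .star else .zero

/-- The number of stars in the pattern matrix. -/
noncomputable def numStars {k n : ℕ} (w : Fin n → Fin k) : ℕ :=
  {ij : Fin k × Fin n | patternMatrix w ij.1 ij.2 = .star}.ncard

/-- `A` arises from the pattern matrix by replacing the stars with complex numbers. -/
def FitsPattern {k n : ℕ} (w : Fin n → Fin k) (A : Matrix (Fin k) (Fin n) ℂ) : Prop :=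
  ∀ i j, (patternMatrix w i j = .one → A i j = 1) ∧ (patternMatrix w i j = .zero → A i j = 0)

/-- The group `U_k(w)` of lower triangular matrices `u` with ones on the diagonal such that
`u i j = 0` below the diagonal whenever `j` is not a letter of `w`. -/
def unipotent {k n : ℕ} (w : Fin n → Fin k) : Set (Matrix (Fin k) (Fin k) ℂ) :=
  {u | (∀ i, u i i = 1) ∧ (∀ i j, i < j → u i j = 0) ∧
    ∀ i j, j < i → j ∉ Set.range w → u i j = 0}

/-- The dimension of `U_k(w)`, which is an affine subspace of the space of matrices. -/
noncomputable def dimUnipotent {k n : ℕ} (w : Fin n → Fin k) : ℕ :=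
  Module.finrank ℂ (vectorSpan ℂ (unipotent w))

/-- The stratum of `w`: the line configurations of the matrices `u * B * t` with `u ∈ U_k(w)`, `B`
fitting the pattern of `w`, and `t` an invertible diagonal matrix. -/
def stratum {k n : ℕ} (w : Fin n → Fin k) : Set (ProjProd k n) :=
  {p | ∃ (A : Matrix (Fin k) (Fin n) ℂ) (hA : ∀ j, A.col j ≠ 0), p = ofMatrix A hA ∧
    ∃ u ∈ unipotent w, ∃ B : Matrix (Fin k) (Fin n) ℂ, FitsPattern w B ∧
      ∃ t : Fin n → ℂˣ, A = u * B * Matrix.diagonal (fun j => (t j : ℂ))}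

end LineConfig

/-! The proof is Gaussian elimination on the columns of a matrix, from left to right. A basis of
ℂ^k, at first the standard one, is kept as the columns of `frame`, and the next column is expanded
in it (`coord`). Its pivot is the nonzero coordinate with the largest `key`: unseen letters take
precedence, smaller ones first, then seen letters, the latest first occurrence first. If the pivot
letter is new, the column, divided by its pivot and cleared of its coordinates at smaller seen
letters, replaces the basis vector of that index; otherwise the basis is kept. The pivot letters
form the word of the matrix. Each letter is determined by the column and the letters before it, and
a nonzero column has a pivot, so there is exactly one word (`exists_adapted`, `Adapted.unique`).

The stars are the coordinates that elimination leaves free outside the basis. By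
`factors_iff_adapted`, the word of `A` is `w` exactly if `A = u * B * t`: the final basis is `u`,
the pivots are `t`, and the remaining coordinates divided by the pivots are the stars of `B`. Hence
the strata partition all configurations. A configuration spans exactly if its word is surjective,
that is, Fubini: a full set of letters puts the final basis into the span of the columns, while a
missing letter gives a zero row of `B`.

As long as the pivots do not vanish, the frames have determinant 1, so frames and coordinates are
multihomogeneous fractions (`isFraction_frame`, `isFraction_coord`). The inverse parametrization
`cellMatrix` is polynomial. This makes each stratum an affine space (`cellHomeomorph` and the two
lemmas on regular functions).

For the paving, consider the open set `pivotOpen w` where the pivots prescribed by `w` are nonzero.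
A configuration in it has a word whose keys are lexicographically at least those of `w`. Putting
Fubini words last respects this, so the words above any threshold have a union of sets `pivotOpen`
as the union of their strata. The complements form the chain, which gains one stratum per step. -/

open scoped Matrix

namespace LineConfig

variable {k n : ℕ}

/-! ### Words, first occurrences, keys and stars -/

/-- The letter `r` occurs in `w` before the position `j`. -/
def Seen (w : Fin n → Fin k) (j : ℕ) (r : Fin k) : Prop :=
  ∃ i : Fin n, i.val < j ∧ w i = r

lemma isInitial_iff {w : Fin n → Fin k} {j : Fin n} : IsInitial w j ↔ ¬ Seen w j (w j) := by
  constructor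
  · rintro h ⟨i, hi, e⟩
    exact h i hi e
  · intro h i hi e
    exact h ⟨i, hi, e⟩

lemma Seen.mono {w : Fin n → Fin k} {i j : ℕ} {r : Fin k} (h : Seen w i r) (hij : i ≤ j) :
    Seen w j r := by
  obtain ⟨a, ha, e⟩ := h
  exact ⟨a, ha.trans_le hij, e⟩

lemma seen_succ {w : Fin n → Fin k} {j : Fin n} {r : Fin k} :
    Seen w (j + 1) r ↔ Seen w j r ∨ r = w j := by
  constructor
  · rintro ⟨a, ha, e⟩
    rcases Nat.lt_succ_iff_lt_or_eq.1 ha with h | h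
    · exact .inl ⟨a, h, e⟩
    · right
      rw [← e, Fin.ext h]
  · rintro (h | rfl)
    · exact h.mono (Nat.le_succ _)
    · exact ⟨j, Nat.lt_succ_self _, rfl⟩

lemma not_seen_zero {w : Fin n → Fin k} {r : Fin k} : ¬ Seen w 0 r := by
  rintro ⟨a, ha, -⟩
  exact absurd ha (Nat.not_lt_zero _)

lemma seen_congr {w w' : Fin n → Fin k} {j : ℕ} (h : ∀ i : Fin n, i.val < j → w i = w' i)
    (r : Fin k) : Seen w j r ↔ Seen w' j r := by
  constructor
  · rintro ⟨a, ha, e⟩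
    exact ⟨a, ha, (h a ha) ▸ e⟩
  · rintro ⟨a, ha, e⟩
    exact ⟨a, ha, (h a ha).symm ▸ e⟩

lemma seen_length {w : Fin n → Fin k} {r : Fin k} : Seen w n r ↔ r ∈ Set.range w :=
  ⟨fun ⟨a, _, e⟩ => ⟨a, e⟩, fun ⟨a, e⟩ => ⟨a, a.2, e⟩⟩

/-- The position of the first occurrence of the letter `r`. -/
noncomputable def firstPos (w : Fin n → Fin k) (r : Fin k) : ℕ :=
  sInf {m : ℕ | ∃ i : Fin n, i.val = m ∧ w i = r}

lemma firstPos_le {w : Fin n → Fin k} {i : Fin n} : firstPos w (w i) ≤ i :=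
  Nat.sInf_le ⟨i, rfl, rfl⟩

lemma exists_firstPos {w : Fin n → Fin k} {j : ℕ} {r : Fin k} (h : Seen w j r) :
    ∃ i : Fin n, i.val = firstPos w r ∧ w i = r ∧ i.val < j ∧ IsInitial w i := by
  obtain ⟨a, ha, e⟩ := h
  have hne : {m : ℕ | ∃ i : Fin n, i.val = m ∧ w i = r}.Nonempty := ⟨a, a, rfl, e⟩
  obtain ⟨i, hi, hr⟩ := Nat.sInf_mem hne
  refine ⟨i, hi, hr, ?_, ?_⟩
  · have : firstPos w r ≤ a := e ▸ firstPos_le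
    unfold firstPos at this
    omega
  · intro i' hi' e'
    have : firstPos w r ≤ i' := by
      rw [← hr, ← e']
      exact firstPos_le
    unfold firstPos at this
    have := Fin.lt_def.1 hi'
    omega

lemma IsInitial.firstPos_eq {w : Fin n → Fin k} {i : Fin n} (h : IsInitial w i) :
    firstPos w (w i) = i := by
  obtain ⟨i', h1, h2, h3, -⟩ := exists_firstPos (w := w) (j := i + 1) (r := w i) ⟨i, by simp, rfl⟩
  rcases Nat.lt_succ_iff_lt_or_eq.1 h3 with h' | h'
  · exact absurd h2 (h i' h')
  · omega

lemma Seen.firstPos_lt {w : Fin n → Fin k} {j : ℕ} {r : Fin k} (h : Seen w j r) :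
    firstPos w r < j := by
  obtain ⟨i, h1, h2, h3, -⟩ := exists_firstPos h
  omega

lemma firstPos_congr {w w' : Fin n → Fin k} {j : ℕ} (h : ∀ i : Fin n, i.val < j → w i = w' i)
    {r : Fin k} (hs : Seen w j r) : firstPos w r = firstPos w' r := by
  have hs' := (seen_congr h r).1 hs
  obtain ⟨i, h1, h2, h3, -⟩ := exists_firstPos hs
  obtain ⟨i', h1', h2', h3', -⟩ := exists_firstPos hs'
  apply le_antisymm
  · rw [← h1', ← h2', ← h i' h3']
    exact firstPos_le
  · rw [← h1, ← h2, h i h3]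
    exact firstPos_le

open Classical in
/-- The order in which the coordinates are tested at position `j`: letters not seen before, in
increasing order, have the largest keys; they are followed by the letters seen before, in the
reverse order of their first occurrences. -/
noncomputable def key (w : Fin n → Fin k) (j : Fin n) (r : Fin k) : ℕ :=
  if Seen w j r then firstPos w r else n + (k - r)

lemma key_congr {w w' : Fin n → Fin k} {j : Fin n} (h : ∀ i < j, w i = w' i) (r : Fin k) :
    key w j r = key w' j r := by
  unfold key
  have hs := seen_congr (j := j) h r
  by_cases h1 : Seen w j r
  · rw [if_pos h1, if_pos (hs.1 h1), firstPos_congr h h1]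
  · rw [if_neg h1, if_neg (fun h' => h1 (hs.2 h'))]

/-- Seen letters have keys below `n` and unseen ones above `n`, because `k - r` is positive; within
each class the key recovers the letter. So a maximal key singles out one pivot. -/
lemma key_injective (w : Fin n → Fin k) (j : Fin n) : Function.Injective (key w j) := by
  intro r s h
  unfold key at h
  have hr := r.2
  have hs := s.2
  have hj := j.2
  split_ifs at h with h1 h2 h2
  · obtain ⟨i, a1, a2, -⟩ := exists_firstPos h1
    obtain ⟨i', b1, b2, -⟩ := exists_firstPos h2
    have : i = i' := Fin.ext (by omega)
    rw [← a2, ← b2, this]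
  · have := h1.firstPos_lt
    omega
  · have := h2.firstPos_lt
    omega
  · exact Fin.ext (by omega)

lemma isStar_iff_of_isInitial {w : Fin n → Fin k} {j : Fin n} (h : IsInitial w j) (r : Fin k) :
    IsStar w r j ↔ Seen w j r ∧ r < w j := by
  constructor
  · rintro (⟨-, h1, h2⟩ | ⟨h1, -⟩)
    · exact ⟨h2, h1⟩
    · exact absurd h h1
  · rintro ⟨h1, h2⟩
    exact .inl ⟨h, h2, h1⟩

lemma isStar_iff_of_not_isInitial {w : Fin n → Fin k} {j : Fin n} (h : ¬ IsInitial w j)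
    (r : Fin k) : IsStar w r j ↔ Seen w j r ∧ firstPos w r < firstPos w (w j) := by
  have hj : Seen w j (w j) := by
    by_contra h'
    exact h (isInitial_iff.2 h')
  constructor
  · rintro (⟨h1, -⟩ | ⟨-, j₁, j₂, h12, i1, rfl, i2, e2⟩)
    · exact absurd h1 h
    · rw [← e2, i1.firstPos_eq, i2.firstPos_eq]
      have := hj.firstPos_lt
      rw [← e2, i2.firstPos_eq] at this
      exact ⟨⟨j₁, (Fin.lt_def.1 h12).trans this, rfl⟩, h12⟩
  · rintro ⟨h1, h2⟩
    obtain ⟨i, a1, a2, -, a3⟩ := exists_firstPos h1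
    obtain ⟨i', b1, b2, -, b3⟩ := exists_firstPos hj
    exact .inr ⟨h, i, i', Fin.lt_def.2 (by omega), a3, a2, b3, b2⟩

lemma not_isStar_self (w : Fin n → Fin k) (j : Fin n) : ¬ IsStar w (w j) j := by
  by_cases h : IsInitial w j
  · rw [isStar_iff_of_isInitial h]
    exact fun h => lt_irrefl _ h.2
  · rw [isStar_iff_of_not_isInitial h]
    exact fun h => lt_irrefl _ h.2

lemma patternMatrix_eq_star {w : Fin n → Fin k} {r : Fin k} {j : Fin n} :
    patternMatrix w r j = .star ↔ IsStar w r j := by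
  unfold patternMatrix
  split_ifs with h1 h2
  · subst h1
    simpa using not_isStar_self w j
  · simpa using h2
  · simpa using h2

lemma fitsPattern_iff {w : Fin n → Fin k} {B : Matrix (Fin k) (Fin n) ℂ} :
    FitsPattern w B ↔ ∀ j, B (w j) j = 1 ∧ ∀ r, r ≠ w j → ¬ IsStar w r j → B r j = 0 := by
  constructor
  · intro h j
    refine ⟨(h _ _).1 (by simp [patternMatrix]), fun r h1 h2 => (h _ _).2 ?_⟩
    simp [patternMatrix, h1, h2]
  · intro h r j
    unfold patternMatrix
    split_ifs with h1 h2
    · subst h1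
      simpa using (h j).1
    · simp
    · simpa using (h j).2 r h1 h2

/-! ### Elimination -/

open Classical in
/-- The coordinate vector `c` of the `j`-th column, divided by its pivot and with the entries
belonging to earlier letters less than `w j` removed. -/
noncomputable def elimCol (w : Fin n → Fin k) (j : Fin n) (c : Fin k → ℂ) : Fin k → ℂ :=
  fun r => if Seen w j r ∧ r < w j then 0 else c r / c (w j)

open Classical in
/-- The basis of `ℂ^k` adapted to the first `j` columns of `A`, as the columns of a matrix. -/
noncomputable def frame (w : Fin n → Fin k) (A : Matrix (Fin k) (Fin n) ℂ) :
    ℕ → Matrix (Fin k) (Fin k) ℂ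
  | 0 => 1
  | j + 1 =>
    if h : j < n then
      if Seen w j (w ⟨j, h⟩) then frame w A j
      else (frame w A j).updateCol (w ⟨j, h⟩) (frame w A j *ᵥ
        elimCol w ⟨j, h⟩ ((frame w A j).adjugate *ᵥ A.col ⟨j, h⟩))
    else frame w A j

/-- The coordinates of the `j`-th column of `A` in the basis adapted to the columns before it. -/
noncomputable def coord (w : Fin n → Fin k) (A : Matrix (Fin k) (Fin n) ℂ) (j : Fin n) :
    Fin k → ℂ :=
  (frame w A j).adjugate *ᵥ A.col j

lemma frame_succ_of_seen {w : Fin n → Fin k} (A : Matrix (Fin k) (Fin n) ℂ) {j : Fin n}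
    (h : Seen w j (w j)) : frame w A (j + 1) = frame w A j := by
  rw [frame, dif_pos j.2, if_pos h]

lemma frame_succ_of_not_seen {w : Fin n → Fin k} (A : Matrix (Fin k) (Fin n) ℂ) {j : Fin n}
    (h : ¬ Seen w j (w j)) : frame w A (j + 1) =
      (frame w A j).updateCol (w j) (frame w A j *ᵥ elimCol w j (coord w A j)) := by
  rw [frame, dif_pos j.2, if_neg h]
  rfl

/-- Induction over the positions of a word, including the one behind its end. -/
lemma position_induction {P : ℕ → Prop} (h0 : P 0) (h : ∀ j : Fin n, P j → P (j + 1)) :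
    ∀ j ≤ n, P j := by
  intro j
  induction j with
  | zero => exact fun _ => h0
  | succ j ih => exact fun hj => h ⟨j, hj⟩ (ih (Nat.le_of_succ_le hj))

lemma frame_congr {w w' : Fin n → Fin k} (A : Matrix (Fin k) (Fin n) ℂ) :
    ∀ j ≤ n, (∀ i : Fin n, i.val < j → w i = w' i) → frame w A j = frame w' A j := by
  apply position_induction
  · exact fun _ => rfl
  · intro j ih h
    have h' : ∀ i : Fin n, i.val < j → w i = w' i := fun i hi => h i (Nat.lt_succ_of_lt hi)
    have hj := h j (Nat.lt_succ_self _)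
    have hs := seen_congr h'
    by_cases h1 : Seen w j (w j)
    · rw [frame_succ_of_seen A h1, frame_succ_of_seen A (by rwa [← hj, ← hs]), ih h']
    · have h2 : ¬ Seen w' j (w' j) := by rwa [← hj, ← hs]
      rw [frame_succ_of_not_seen A h1, frame_succ_of_not_seen A h2, ih h', coord, coord, ih h', hj]
      congr 2
      funext r
      have e : Seen w j r ∧ r < w j ↔ Seen w' j r ∧ r < w' j := by rw [hs, hj]
      unfold elimCol
      by_cases hr : Seen w j r ∧ r < w j
      · rw [if_pos hr, if_pos (e.1 hr)]
      · rw [if_neg hr, if_neg (fun h => hr (e.2 h)), hj]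

lemma coord_congr {w w' : Fin n → Fin k} (A : Matrix (Fin k) (Fin n) ℂ) {j : Fin n}
    (h : ∀ i < j, w i = w' i) : coord w A j = coord w' A j := by
  rw [coord, coord, frame_congr A j j.2.le h]

/-- By Cramer's rule, replacing column `r` of `M` by `M *ᵥ x` multiplies the determinant by `x r`,
and here that entry is pivot over pivot. As the determinant stays 1, the adjugate used in `coord` is
the inverse. -/
lemma det_frame {w : Fin n → Fin k} {A : Matrix (Fin k) (Fin n) ℂ} :
    ∀ j ≤ n, (∀ i : Fin n, i.val < j → coord w A i (w i) ≠ 0) → (frame w A j).det = 1 := by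
  apply position_induction
  · intro _
    simp [frame]
  · intro j ih h
    have ih := ih fun i hi => h i (Nat.lt_succ_of_lt hi)
    by_cases h1 : Seen w j (w j)
    · rw [frame_succ_of_seen A h1, ih]
    · rw [frame_succ_of_not_seen A h1, ← Matrix.cramer_apply, Matrix.cramer_eq_adjugate_mulVec,
        Matrix.mulVec_mulVec, Matrix.adjugate_mul, ih, one_smul, Matrix.one_mulVec, elimCol,
        if_neg (fun h => lt_irrefl _ h.2), div_self (h j (Nat.lt_succ_self _))]

lemma frame_mulVec_coord {w : Fin n → Fin k} {A : Matrix (Fin k) (Fin n) ℂ} {j : Fin n}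
    (h : (frame w A j).det = 1) : frame w A j *ᵥ coord w A j = A.col j := by
  rw [coord, Matrix.mulVec_mulVec, Matrix.mul_adjugate, h, one_smul, Matrix.one_mulVec]

lemma coord_eq_of_frame_mulVec {w : Fin n → Fin k} {A : Matrix (Fin k) (Fin n) ℂ} {j : Fin n}
    (h : (frame w A j).det = 1) {c : Fin k → ℂ} (hc : frame w A j *ᵥ c = A.col j) :
    coord w A j = c := by
  rw [coord, ← hc, Matrix.mulVec_mulVec, Matrix.adjugate_mul, h, one_smul, Matrix.one_mulVec]

/-- Elimination subtracts from a column only multiples of basis vectors at seen letters, which lie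
in the span by induction. -/
lemma col_frame_mem_span {w : Fin n → Fin k} {A : Matrix (Fin k) (Fin n) ℂ} :
    ∀ j ≤ n, (∀ i : Fin n, i.val < j → coord w A i (w i) ≠ 0) → ∀ r, Seen w j r →
      (frame w A j).col r ∈ Submodule.span ℂ (Set.range A.col) := by
  classical
  apply position_induction
  · exact fun _ r h => absurd h not_seen_zero
  · intro j ih h r hr
    have h' : ∀ i : Fin n, i.val < j → coord w A i (w i) ≠ 0 :=
      fun i hi => h i (Nat.lt_succ_of_lt hi)
    have ih := ih h'
    by_cases h1 : Seen w j (w j)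
    · rw [frame_succ_of_seen A h1]
      refine ih r ?_
      rcases seen_succ.1 hr with h2 | rfl
      · exact h2
      · exact h1
    · rw [frame_succ_of_not_seen A h1]
      rcases seen_succ.1 hr with h2 | rfl
      · have hne : r ≠ w j := by
          rintro rfl
          exact h1 h2
        convert ih r h2 using 1
        ext i
        simp [Matrix.updateCol_ne hne]
      · have e : (Matrix.updateCol (frame w A j) (w j)
            (frame w A j *ᵥ elimCol w j (coord w A j))).col (w j) =
            (coord w A j (w j))⁻¹ • A.col j - ∑ r, (if Seen w j r ∧ r < w j then
              coord w A j r / coord w A j (w j) else 0) • (frame w A j).col r := by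
          have hE : elimCol w j (coord w A j) = (coord w A j (w j))⁻¹ • coord w A j -
              fun r => (if Seen w j r ∧ r < w j then
                coord w A j r / coord w A j (w j) else 0) := by
            funext r
            simp only [elimCol, Pi.sub_apply, Pi.smul_apply, smul_eq_mul]
            split_ifs
            · ring
            · ring
          have e1 : (Matrix.updateCol (frame w A j) (w j)
            (frame w A j *ᵥ elimCol w j (coord w A j))).col (w j) =
              frame w A j *ᵥ elimCol w j (coord w A j) := by
            ext i
            simp
          rw [e1, hE, Matrix.mulVec_sub, Matrix.mulVec_smul,
            frame_mulVec_coord (det_frame j j.2.le h')]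
          congr 1
          ext i
          simp only [Matrix.mulVec, dotProduct, Finset.sum_apply, Pi.smul_apply, Matrix.col_apply,
            smul_eq_mul]
          exact Finset.sum_congr rfl fun s _ => mul_comm _ _
        rw [e]
        refine Submodule.sub_mem _ (Submodule.smul_mem _ _ (Submodule.subset_span ⟨j, rfl⟩))
          (Submodule.sum_mem _ fun s _ => ?_)
        split_ifs with hs
        · exact Submodule.smul_mem _ _ (ih s hs.1)
        · simp

/-- The word `w` describes the matrix `A`: in the basis adapted to the columns before the `j`-th
one, the nonzero coordinate of the `j`-th column with the largest key is that of `w j`. -/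
def Adapted (w : Fin n → Fin k) (A : Matrix (Fin k) (Fin n) ℂ) : Prop :=
  ∀ j, coord w A j (w j) ≠ 0 ∧ ∀ r, coord w A j r ≠ 0 → key w j r ≤ key w j (w j)

/-- The matrix `A` is a product as in the definition of the stratum of `w`. -/
def Factors (w : Fin n → Fin k) (A : Matrix (Fin k) (Fin n) ℂ) : Prop :=
  ∃ u ∈ unipotent w, ∃ B : Matrix (Fin k) (Fin n) ℂ, FitsPattern w B ∧
    ∃ t : Fin n → ℂˣ, A = u * B * Matrix.diagonal (fun j => (t j : ℂ))

/-- This and the next lemma match the pivot rule with the pattern. At an initial position the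
coordinates beyond the stars, at `r ≥ w j`, form the new column of `u`; at a non-initial one only
the stars and the pivot remain. -/
lemma key_le_iff_of_isInitial {w : Fin n → Fin k} {j : Fin n} (h : IsInitial w j) (r : Fin k) :
    key w j r ≤ key w j (w j) ↔ IsStar w r j ∨ w j ≤ r := by
  rw [isStar_iff_of_isInitial h]
  rw [isInitial_iff] at h
  unfold key
  rw [if_neg h]
  have h1 := r.2
  have h2 := (w j).2
  split_ifs with h3
  · have := h3.firstPos_lt
    have := j.2
    refine iff_of_true (by omega) ?_
    rcases lt_or_ge r (w j) with h4 | h4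
    · exact .inl ⟨h3, h4⟩
    · exact .inr h4
  · rw [Fin.le_def]
    constructor
    · intro h4
      right
      omega
    · rintro (h4 | h4)
      · exact absurd h4.1 h3
      · omega

lemma key_le_iff_of_not_isInitial {w : Fin n → Fin k} {j : Fin n} (h : ¬ IsInitial w j)
    (r : Fin k) : key w j r ≤ key w j (w j) ↔ IsStar w r j ∨ r = w j := by
  rw [isStar_iff_of_not_isInitial h]
  rw [isInitial_iff, not_not] at h
  by_cases h3 : Seen w j r
  · rw [le_iff_lt_or_eq, (key_injective w j).eq_iff]
    unfold key
    rw [if_pos h, if_pos h3]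
    tauto
  · have h4 : r ≠ w j := by
      rintro rfl
      exact h3 h
    refine iff_of_false ?_ (by tauto)
    unfold key
    rw [if_pos h, if_neg h3]
    have := h.firstPos_lt
    have := j.2
    omega

/-! ### Lower triangular matrices acting on vectors -/

lemma mulVec_congr {M N : Matrix (Fin k) (Fin k) ℂ} {x : Fin k → ℂ}
    (h : ∀ s, x s ≠ 0 → M.col s = N.col s) : M *ᵥ x = N *ᵥ x := by
  ext i
  simp only [Matrix.mulVec, dotProduct]
  refine Finset.sum_congr rfl fun s _ => ?_
  by_cases hs : x s = 0
  · simp [hs]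
  · have := congrFun (h s hs) i
    exact congrArg (· * x s) this

lemma mulVec_apply_of_lt {M : Matrix (Fin k) (Fin k) ℂ} (hM : ∀ i s, i < s → M i s = 0)
    {x : Fin k → ℂ} {a : Fin k} (hx : ∀ s < a, x s = 0) {i : Fin k} (hi : i < a) :
    (M *ᵥ x) i = 0 := by
  rw [Matrix.mulVec, dotProduct]
  refine Finset.sum_eq_zero fun s _ => ?_
  rcases lt_or_ge s a with h | h
  · rw [hx s h, mul_zero]
  · rw [hM i s (hi.trans_le h), zero_mul]

lemma mulVec_apply_self {M : Matrix (Fin k) (Fin k) ℂ} (hM : ∀ i s, i < s → M i s = 0)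
    {x : Fin k → ℂ} {a : Fin k} (hx : ∀ s < a, x s = 0) : (M *ᵥ x) a = M a a * x a := by
  rw [Matrix.mulVec, dotProduct]
  refine Finset.sum_eq_single a (fun s _ hs => ?_) (by simp)
  rcases lt_or_gt_of_ne hs with h | h
  · rw [hx s h, mul_zero]
  · rw [hM a s h, zero_mul]

lemma eq_zero_of_mulVec_apply_eq_zero {M : Matrix (Fin k) (Fin k) ℂ}
    (hM : ∀ i s, i < s → M i s = 0) (hM1 : ∀ i, M i i = 1) {x : Fin k → ℂ} {a : Fin k}
    (hx : ∀ i < a, (M *ᵥ x) i = 0) : ∀ i < a, x i = 0 := by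
  intro i
  induction i using WellFoundedLT.induction with
  | ind i ih =>
    intro hi
    have := mulVec_apply_self hM (x := x) (a := i) fun s hs => ih s hs (hs.trans hi)
    rw [hx i hi, hM1, one_mul] at this
    exact this.symm

lemma eq_mul_diagonal_iff {u : Matrix (Fin k) (Fin k) ℂ} {A B : Matrix (Fin k) (Fin n) ℂ}
    {t : Fin n → ℂ} :
    A = u * B * Matrix.diagonal t ↔ ∀ j, A.col j = t j • (u *ᵥ B.col j) := by
  constructor
  · rintro rfl j
    ext i
    simp only [Matrix.col_apply, Matrix.mul_diagonal, Pi.smul_apply, smul_eq_mul]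
    rw [mul_comm]
    rfl
  · intro h
    ext i j
    have := congrFun (h j) i
    simp only [Matrix.col_apply, Pi.smul_apply, smul_eq_mul] at this
    rw [this, Matrix.mul_diagonal, mul_comm]
    rfl

/-- Only the column of a new letter is ever replaced, so each column is final once its letter has
been seen. -/
lemma col_frame_of_seen (w : Fin n → Fin k) (A : Matrix (Fin k) (Fin n) ℂ) {i : ℕ} {r : Fin k}
    (hr : Seen w i r) : ∀ j ≤ n, i ≤ j → (frame w A j).col r = (frame w A i).col r := by
  apply position_induction
  · intro h
    rw [Nat.le_zero.1 h]
  · intro j ih h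
    rcases Nat.le_succ_iff.1 h with h | h
    · rw [← ih h]
      by_cases h1 : Seen w j (w j)
      · rw [frame_succ_of_seen A h1]
      · have hne : r ≠ w j := by
          rintro rfl
          exact h1 (hr.mono h)
        rw [frame_succ_of_not_seen A h1]
        ext s
        simp [Matrix.updateCol_ne hne]
    · rw [h]

/-! ### Adapted matrices have a factorization -/

/-- Below `w j`, coordinates at seen letters are cleared, and those at unseen letters already vanish
because their keys exceed that of the pivot. This keeps the frame lower triangular. -/
lemma Adapted.elimCol_eq_zero {w : Fin n → Fin k} {A : Matrix (Fin k) (Fin n) ℂ}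
    (h : Adapted w A) {j : Fin n} (hj : IsInitial w j) {s : Fin k} (hs : s < w j) :
    elimCol w j (coord w A j) s = 0 := by
  unfold elimCol
  split_ifs with h1
  · rfl
  · by_contra h2
    have h3 : coord w A j s ≠ 0 := fun h3 => h2 (by rw [h3, zero_div])
    have := (h j).2 s h3
    rw [key_le_iff_of_isInitial hj, isStar_iff_of_isInitial hj] at this
    rcases this with h4 | h4
    · exact h1 h4
    · exact absurd hs (not_lt.2 h4)

lemma Adapted.elimCol_self {w : Fin n → Fin k} {A : Matrix (Fin k) (Fin n) ℂ}
    (h : Adapted w A) (j : Fin n) : elimCol w j (coord w A j) (w j) = 1 := by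
  unfold elimCol
  rw [if_neg (fun h => lt_irrefl _ h.2), div_self (h j).1]

lemma Adapted.frame_apply {w : Fin n → Fin k} {A : Matrix (Fin k) (Fin n) ℂ}
    (h : Adapted w A) : ∀ j ≤ n, (∀ r, frame w A j r r = 1) ∧ (∀ r s, r < s → frame w A j r s = 0) ∧
      ∀ r s, r ≠ s → ¬ Seen w j s → frame w A j r s = 0 := by
  apply position_induction
  · refine ⟨fun r => ?_, fun r s hrs => ?_, fun r s hrs _ => ?_⟩
    · simp [frame]
    · simp [frame, hrs.ne]
    · simp [frame, hrs]
  · rintro j ⟨ih1, ih2, ih3⟩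
    by_cases h1 : Seen w j (w j)
    · rw [frame_succ_of_seen A h1]
      exact ⟨ih1, ih2, fun r s hrs hs => ih3 r s hrs fun h' => hs (h'.mono (Nat.le_succ _))⟩
    · have hj := isInitial_iff.2 h1
      have hz : ∀ s < w j, elimCol w j (coord w A j) s = 0 := fun s hs => h.elimCol_eq_zero hj hs
      rw [frame_succ_of_not_seen A h1]
      simp only [Matrix.updateCol_apply]
      refine ⟨fun r => ?_, fun r s hrs => ?_, fun r s hrs hs => ?_⟩
      · split_ifs with h2
        · subst h2
          rw [mulVec_apply_self ih2 hz, ih1, h.elimCol_self, one_mul]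
        · exact ih1 r
      · split_ifs with h2
        · subst h2
          exact mulVec_apply_of_lt ih2 hz hrs
        · exact ih2 r s hrs
      · rw [seen_succ, not_or] at hs
        rw [if_neg hs.2]
        exact ih3 r s hrs hs.1

lemma Adapted.det_frame {w : Fin n → Fin k} {A : Matrix (Fin k) (Fin n) ℂ}
    (h : Adapted w A) (j : Fin n) : (frame w A j).det = 1 :=
  LineConfig.det_frame j j.2.le fun i _ => (h i).1

lemma Adapted.factors {w : Fin n → Fin k} {A : Matrix (Fin k) (Fin n) ℂ}
    (h : Adapted w A) : Factors w A := by
  classical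
  obtain ⟨f1, f2, f3⟩ := h.frame_apply n le_rfl
  let S : Fin n → Fin k → ℂ := fun j r =>
    if IsStar w r j then coord w A j r / coord w A j (w j) else 0
  refine ⟨frame w A n, ⟨f1, f2, fun r s hrs hs => f3 r s hrs.ne' (by rwa [seen_length])⟩,
    Matrix.of fun r j => (Pi.single (w j) 1 + S j : Fin k → ℂ) r, ?_,
    fun j => Units.mk0 _ (h j).1, ?_⟩
  · rw [fitsPattern_iff]
    intro j
    constructor
    · simp [S, not_isStar_self]
    · intro r h1 h2
      simp [S, h1, h2]
  · rw [eq_mul_diagonal_iff]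
    intro j
    have hcol : (Matrix.of fun r j => (Pi.single (w j) 1 + S j : Fin k → ℂ) r : Matrix (Fin k) (Fin n) ℂ).col j
        = Pi.single (w j) 1 + S j := rfl
    rw [hcol, Units.val_mk0, ← frame_mulVec_coord (h.det_frame j)]
    -- Stars lie in rows of seen letters, whose basis vectors are already final.
    have hS : frame w A n *ᵥ S j = frame w A j *ᵥ S j := by
      refine mulVec_congr fun s hs => col_frame_of_seen w A ?_ n le_rfl j.2.le
      have hs : IsStar w s j := by
        by_contra h'
        simp [S, h'] at hs
      by_cases hj : IsInitial w j
      · exact ((isStar_iff_of_isInitial hj s).1 hs).1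
      · exact ((isStar_iff_of_not_isInitial hj s).1 hs).1
    rw [Matrix.mulVec_add, hS]
    by_cases hj : IsInitial w j
    · have h1 := isInitial_iff.1 hj
      -- The final basis vector of a new letter is the eliminated column installed at this position;
      -- adding back the cleared star coordinates gives the column over its pivot.
      have e1 : frame w A n *ᵥ Pi.single (w j) 1 = frame w A j *ᵥ elimCol w j (coord w A j) := by
        rw [Matrix.mulVec_single_one, col_frame_of_seen w A (seen_succ.2 (.inr rfl)) n le_rfl j.2,
          frame_succ_of_not_seen A h1]
        ext i
        simp
      rw [e1, ← Matrix.mulVec_add, ← Matrix.mulVec_smul]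
      congr 1
      ext r
      have := (h j).1
      simp only [S, elimCol, Pi.smul_apply, Pi.add_apply, smul_eq_mul, isStar_iff_of_isInitial hj]
      split_ifs
      · field_simp
        simp
      · field_simp
        simp
    · have h1 : Seen w j (w j) := by
        rwa [isInitial_iff, not_not] at hj
      have e1 : frame w A n *ᵥ Pi.single (w j) 1 = frame w A j *ᵥ Pi.single (w j) 1 := by
        rw [Matrix.mulVec_single_one, Matrix.mulVec_single_one,
          col_frame_of_seen w A h1 n le_rfl j.2.le]
      rw [e1, ← Matrix.mulVec_add, ← Matrix.mulVec_smul]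
      congr 1
      ext r
      have h0 := (h j).1
      have h2 := (h j).2 r
      rw [key_le_iff_of_not_isInitial hj] at h2
      by_cases hr : r = w j
      · subst hr
        simp [S, not_isStar_self]
      · by_cases hs : IsStar w r j
        · simp only [S, if_pos hs, Pi.smul_apply, Pi.add_apply, Pi.single_eq_of_ne hr, smul_eq_mul]
          field_simp
          simp
        · have : coord w A j r = 0 := by
            by_contra h'
            exact (h2 h').elim hs hr
          simp [S, hs, Pi.single_eq_of_ne hr, this]

/-! ### The frame of a factored matrix -/

open Classical in
/-- The matrix whose columns are those of `u` for the letters of `w` before the position `j` and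
standard unit vectors otherwise. -/
noncomputable def partialFrame (w : Fin n → Fin k) (u : Matrix (Fin k) (Fin k) ℂ) (j : ℕ) :
    Matrix (Fin k) (Fin k) ℂ :=
  Matrix.of fun r s => if Seen w j s then u r s else (1 : Matrix (Fin k) (Fin k) ℂ) r s

lemma partialFrame_apply_of_seen {w : Fin n → Fin k} (u : Matrix (Fin k) (Fin k) ℂ) {j : ℕ}
    {s : Fin k} (hs : Seen w j s) (r : Fin k) : partialFrame w u j r s = u r s :=
  if_pos hs

lemma partialFrame_apply_of_not_seen {w : Fin n → Fin k} (u : Matrix (Fin k) (Fin k) ℂ) {j : ℕ}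
    {s : Fin k} (hs : ¬ Seen w j s) (r : Fin k) :
    partialFrame w u j r s = (1 : Matrix (Fin k) (Fin k) ℂ) r s :=
  if_neg hs

lemma partialFrame_apply_self {w : Fin n → Fin k} {u : Matrix (Fin k) (Fin k) ℂ}
    (hu : u ∈ unipotent w) (j : ℕ) (r : Fin k) : partialFrame w u j r r = 1 := by
  simp [partialFrame, hu.1]

lemma partialFrame_apply_of_lt {w : Fin n → Fin k} {u : Matrix (Fin k) (Fin k) ℂ}
    (hu : u ∈ unipotent w) (j : ℕ) (r s : Fin k) (hrs : r < s) : partialFrame w u j r s = 0 := by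
  simp [partialFrame, hu.2.1 r s hrs, hrs.ne]

lemma det_partialFrame {w : Fin n → Fin k} {u : Matrix (Fin k) (Fin k) ℂ}
    (hu : u ∈ unipotent w) (j : ℕ) : (partialFrame w u j).det = 1 := by
  rw [Matrix.det_of_isLowerTriangular _ fun r s hrs => partialFrame_apply_of_lt hu j r s hrs]
  simp [partialFrame_apply_self hu]

lemma col_partialFrame {w : Fin n → Fin k} {u : Matrix (Fin k) (Fin k) ℂ} {j : ℕ} {s : Fin k}
    (hs : Seen w j s) : (partialFrame w u j).col s = u.col s := by
  ext r
  simp [partialFrame, hs]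

lemma coord_of_factors_of_not_isInitial {w : Fin n → Fin k} {u : Matrix (Fin k) (Fin k) ℂ}
    (hu : u ∈ unipotent w) {A B : Matrix (Fin k) (Fin n) ℂ} (hB : FitsPattern w B)
    {t : Fin n → ℂ} (hA : A = u * B * Matrix.diagonal t) {j : Fin n}
    (hf : frame w A j = partialFrame w u j) (hj : ¬ IsInitial w j) :
    coord w A j = t j • B.col j := by
  rw [eq_mul_diagonal_iff] at hA
  apply coord_eq_of_frame_mulVec
  · rw [hf, det_partialFrame hu]
  · rw [hA, Matrix.mulVec_smul, hf]
    congr 1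
    refine mulVec_congr fun s hs => col_partialFrame ?_
    by_cases hs' : s = w j
    · rw [hs']
      rwa [isInitial_iff, not_not] at hj
    · refine ((isStar_iff_of_not_isInitial hj s).1 ?_).1
      by_contra h
      exact hs (((fitsPattern_iff.1 hB) j).2 s hs' h)

-- The vector `z` expands the column `u.col (w j)` in the current frame. It inherits zeros below
-- index `w j` by forward substitution, so its support is disjoint from the stars, and elimination
-- can separate the two summands.
open Classical in
lemma coord_of_factors_of_isInitial {w : Fin n → Fin k} {u : Matrix (Fin k) (Fin k) ℂ}
    (hu : u ∈ unipotent w) {A B : Matrix (Fin k) (Fin n) ℂ} (hB : FitsPattern w B)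
    {t : Fin n → ℂ} (hA : A = u * B * Matrix.diagonal t) {j : Fin n}
    (hf : frame w A j = partialFrame w u j) (hj : IsInitial w j) :
    ∃ z : Fin k → ℂ, frame w A j *ᵥ z = u.col (w j) ∧ (∀ s < w j, z s = 0) ∧ z (w j) = 1 ∧
      coord w A j = t j • (z + fun r => if IsStar w r j then B r j else 0) := by
  have hd : (frame w A j).det = 1 := by rw [hf, det_partialFrame hu]
  have hz : frame w A j *ᵥ ((frame w A j).adjugate *ᵥ u.col (w j)) = u.col (w j) := by
    rw [Matrix.mulVec_mulVec, Matrix.mul_adjugate, hd, one_smul, Matrix.one_mulVec]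
  have hM1 : ∀ i, frame w A j i i = 1 := by
    rw [hf]
    exact partialFrame_apply_self hu j
  have hM : ∀ i s, i < s → frame w A j i s = 0 := by
    rw [hf]
    exact partialFrame_apply_of_lt hu j
  have hz0 := eq_zero_of_mulVec_apply_eq_zero hM hM1 (x := (frame w A j).adjugate *ᵥ u.col (w j))
    (a := w j) fun i hi => by
      rw [hz, Matrix.col_apply, hu.2.1 i _ hi]
  refine ⟨_, hz, hz0, ?_, ?_⟩
  · have := mulVec_apply_self hM hz0
    rwa [hz, Matrix.col_apply, hu.1, hM1, one_mul, eq_comm] at this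
  · rw [eq_mul_diagonal_iff] at hA
    apply coord_eq_of_frame_mulVec hd
    rw [hA, Matrix.mulVec_smul, Matrix.mulVec_add, hz]
    have hcol : B.col j = Pi.single (w j) 1 + fun r => if IsStar w r j then B r j else 0 := by
      ext r
      by_cases hr : r = w j
      · subst hr
        simp [not_isStar_self, (fitsPattern_iff.1 hB j).1]
      · by_cases hs : IsStar w r j
        · simp [hr, hs]
        · simp [hr, hs, (fitsPattern_iff.1 hB j).2 r hr hs]
    rw [hcol, Matrix.mulVec_add, Matrix.mulVec_single_one]
    congr 2
    rw [hf]
    refine mulVec_congr fun s hs => col_partialFrame ?_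
    have hs : IsStar w s j := by
      by_contra h'
      simp [h'] at hs
    exact ((isStar_iff_of_isInitial hj s).1 hs).1

/-- Elimination recovers `u` column by column: at a new letter it removes exactly the star part and
the scalar `t j`, leaving `z`, hence the column of `u`. This gives uniqueness of the factorization.
-/
lemma frame_of_factors {w : Fin n → Fin k} {u : Matrix (Fin k) (Fin k) ℂ}
    (hu : u ∈ unipotent w) {A B : Matrix (Fin k) (Fin n) ℂ} (hB : FitsPattern w B)
    {t : Fin n → ℂ} (ht : ∀ j, t j ≠ 0) (hA : A = u * B * Matrix.diagonal t) :
    ∀ j ≤ n, frame w A j = partialFrame w u j := by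
  apply position_induction
  · ext r s
    simp [frame, partialFrame, not_seen_zero]
  · intro j ih
    by_cases h1 : Seen w j (w j)
    · rw [frame_succ_of_seen A h1, ih]
      have hs : ∀ s, Seen w (j + 1) s ↔ Seen w j s := by
        intro s
        rw [seen_succ]
        constructor
        · rintro (h | rfl)
          · exact h
          · exact h1
        · exact .inl
      ext r s
      by_cases h : Seen w j s
      · rw [partialFrame_apply_of_seen u h, partialFrame_apply_of_seen u ((hs s).2 h)]
      · rw [partialFrame_apply_of_not_seen u h,
          partialFrame_apply_of_not_seen u (mt (hs s).1 h)]
    · have hj := isInitial_iff.2 h1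
      obtain ⟨z, hz, hz0, hz1, hc⟩ := coord_of_factors_of_isInitial hu hB hA ih hj
      have he : elimCol w j (coord w A j) = z := by
        have htj := ht j
        funext r
        unfold elimCol
        split_ifs with h2
        · exact (hz0 r h2.2).symm
        · rw [← isStar_iff_of_isInitial hj] at h2
          rw [hc]
          simp only [Pi.smul_apply, Pi.add_apply, hz1, not_isStar_self, h2, if_false, add_zero,
            smul_eq_mul, mul_one]
          field_simp
      rw [frame_succ_of_not_seen A h1, he, hz, ih]
      ext r s
      rw [Matrix.updateCol_apply]
      split_ifs with hs
      · rw [partialFrame_apply_of_seen u (seen_succ.2 (.inr hs)), hs, Matrix.col_apply]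
      · by_cases h : Seen w j s
        · rw [partialFrame_apply_of_seen u h,
            partialFrame_apply_of_seen u (seen_succ.2 (.inl h))]
        · rw [partialFrame_apply_of_not_seen u h, partialFrame_apply_of_not_seen u
            (mt seen_succ.1 (not_or.2 ⟨h, hs⟩))]

lemma coord_of_factors {w : Fin n → Fin k} {u : Matrix (Fin k) (Fin k) ℂ}
    (hu : u ∈ unipotent w) {A B : Matrix (Fin k) (Fin n) ℂ} (hB : FitsPattern w B)
    {t : Fin n → ℂ} (ht : ∀ j, t j ≠ 0) (hA : A = u * B * Matrix.diagonal t) (j : Fin n) :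
    coord w A j (w j) = t j ∧ (∀ r, IsStar w r j → coord w A j r = t j * B r j) ∧
      ∀ r, coord w A j r ≠ 0 → key w j r ≤ key w j (w j) := by
  have hf := frame_of_factors hu hB ht hA j j.2.le
  have hB' := fitsPattern_iff.1 hB j
  by_cases hj : IsInitial w j
  · obtain ⟨z, hz, hz0, hz1, hc⟩ := coord_of_factors_of_isInitial hu hB hA hf hj
    rw [hc]
    refine ⟨?_, fun r hr => ?_, fun r hr => ?_⟩
    · simp [hz1, not_isStar_self]
    · simp [hr, hz0 r ((isStar_iff_of_isInitial hj r).1 hr).2]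
    · rw [key_le_iff_of_isInitial hj]
      by_contra h
      rw [not_or, not_le] at h
      simp [h.1, hz0 r h.2] at hr
  · rw [coord_of_factors_of_not_isInitial hu hB hA hf hj]
    refine ⟨?_, fun r hr => ?_, fun r hr => ?_⟩
    · simp [hB'.1]
    · simp
    · rw [key_le_iff_of_not_isInitial hj]
      by_contra h
      rw [not_or] at h
      simp [hB'.2 r h.2 h.1] at hr

lemma factors_iff_adapted {w : Fin n → Fin k} {A : Matrix (Fin k) (Fin n) ℂ} :
    Factors w A ↔ Adapted w A := by
  refine ⟨?_, Adapted.factors⟩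
  rintro ⟨u, hu, B, hB, t, hA⟩ j
  have := coord_of_factors hu hB (fun j => (t j).ne_zero) hA j
  refine ⟨?_, this.2.2⟩
  rw [this.1]
  exact (t j).ne_zero

/-! ### Existence and uniqueness of the word of a line configuration -/

/-- The condition of `Adapted` at a single position. -/
def AdaptedAt (w : Fin n → Fin k) (A : Matrix (Fin k) (Fin n) ℂ) (j : Fin n) : Prop :=
  coord w A j (w j) ≠ 0 ∧ ∀ r, coord w A j r ≠ 0 → key w j r ≤ key w j (w j)

lemma AdaptedAt.congr {w w' : Fin n → Fin k} {A : Matrix (Fin k) (Fin n) ℂ} {j : Fin n}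
    (h : AdaptedAt w A j) (hw : ∀ i ≤ j, w i = w' i) : AdaptedAt w' A j := by
  have hw' : ∀ i < j, w i = w' i := fun i hi => hw i hi.le
  unfold AdaptedAt
  rw [← coord_congr A hw', ← hw j le_rfl]
  refine ⟨h.1, fun r hr => ?_⟩
  rw [← key_congr hw', ← key_congr hw']
  exact h.2 r hr

lemma exists_adapted {A : Matrix (Fin k) (Fin n) ℂ} (hA : ∀ j, A.col j ≠ 0) :
    ∃ w, Adapted w A := by
  classical
  suffices h : ∀ j ≤ n, ∃ w : Fin n → Fin k, ∀ i : Fin n, i.val < j → AdaptedAt w A i by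
    obtain ⟨w, hw⟩ := h n le_rfl
    exact ⟨w, fun j => hw j j.2⟩
  apply position_induction
  -- Any word will do here; nonzero columns supply a letter for every position.
  · choose w hw using fun j => Function.ne_iff.1 (hA j)
    exact ⟨w, fun i hi => absurd hi (Nat.not_lt_zero _)⟩
  · rintro j ⟨w, hw⟩
    have hdet : (frame w A j).det = 1 := det_frame j j.2.le fun i hi => (hw i hi).1
    have hc : coord w A j ≠ 0 := by
      intro h
      have := frame_mulVec_coord hdet
      rw [h, Matrix.mulVec_zero] at this
      exact hA j this.symm
    obtain ⟨r₀, hr₀⟩ := Function.ne_iff.1 hc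
    obtain ⟨r, hr, hmax⟩ := Finset.exists_max_image
      (Finset.univ.filter fun r => coord w A j r ≠ 0) (key w j) ⟨r₀, by simpa using hr₀⟩
    have hlt : ∀ i < j, w i = Function.update w j r i := fun i hi => by
      rw [Function.update_of_ne hi.ne]
    refine ⟨Function.update w j r, fun i hi => ?_⟩
    rcases Nat.lt_succ_iff_lt_or_eq.1 hi with hi | hi
    · exact (hw i hi).congr fun i' hi' => hlt i' (hi'.trans_lt hi)
    · rw [Fin.ext hi]
      unfold AdaptedAt
      rw [← coord_congr A hlt, Function.update_self]
      simp only [← key_congr hlt]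
      exact ⟨by simpa using hr, fun s hs => hmax s (by simpa using hs)⟩

/-- Words agreeing before `j` give the same coordinates and keys at `j`, so both letters maximize
the same injective key over the same support. -/
lemma Adapted.unique {w w' : Fin n → Fin k} {A : Matrix (Fin k) (Fin n) ℂ} (h : Adapted w A)
    (h' : Adapted w' A) : w = w' := by
  funext j
  induction j using WellFoundedLT.induction with
  | ind j ih =>
    have hc := coord_congr A ih
    apply key_injective w j
    apply le_antisymm
    · rw [key_congr ih, key_congr ih]
      apply (h' j).2
      rw [← hc]
      exact (h j).1
    · apply (h j).2
      rw [hc]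
      exact (h' j).1

/-! ### From matrices to tuples of lines -/

/-- The matrix of the chosen representatives of a tuple of lines. -/
noncomputable def repMatrix (p : ProjProd k n) : Matrix (Fin k) (Fin n) ℂ :=
  Matrix.of fun i j => (p j).rep i

lemma repMatrix_col_ne_zero (p : ProjProd k n) (j : Fin n) : (repMatrix p).col j ≠ 0 :=
  (p j).rep_nonzero

lemma ofMatrix_repMatrix (p : ProjProd k n) :
    ofMatrix (repMatrix p) (repMatrix_col_ne_zero p) = p :=
  funext fun j => (p j).mk_rep

lemma repMatrix_ofMatrix {A : Matrix (Fin k) (Fin n) ℂ} (hA : ∀ j, A.col j ≠ 0) :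
    ∃ s : Fin n → ℂˣ, repMatrix (ofMatrix A hA) = A * Matrix.diagonal fun j => (s j : ℂ) := by
  choose s hs using fun j => Projectivization.exists_smul_eq_mk_rep ℂ (A.col j) (hA j)
  refine ⟨s, ?_⟩
  ext i j
  rw [Matrix.mul_diagonal, mul_comm]
  exact (congrFun (hs j) i).symm

lemma Factors.mul_diagonal {w : Fin n → Fin k} {A : Matrix (Fin k) (Fin n) ℂ}
    (h : Factors w A) (s : Fin n → ℂˣ) : Factors w (A * Matrix.diagonal fun j => (s j : ℂ)) := by
  obtain ⟨u, hu, B, hB, t, rfl⟩ := h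
  refine ⟨u, hu, B, hB, t * s, ?_⟩
  rw [Matrix.mul_assoc, Matrix.diagonal_mul_diagonal]
  rfl

lemma mem_stratum_iff_factors {w : Fin n → Fin k} {p : ProjProd k n} :
    p ∈ stratum w ↔ Factors w (repMatrix p) := by
  constructor
  · rintro ⟨A, hA, rfl, h⟩
    obtain ⟨s, hs⟩ := repMatrix_ofMatrix hA
    rw [hs]
    exact Factors.mul_diagonal h s
  · intro h
    exact ⟨repMatrix p, repMatrix_col_ne_zero p, (ofMatrix_repMatrix p).symm, h⟩

lemma mem_stratum_iff {w : Fin n → Fin k} {p : ProjProd k n} :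
    p ∈ stratum w ↔ Adapted w (repMatrix p) := by
  rw [mem_stratum_iff_factors, factors_iff_adapted]

lemma exists_mem_stratum (p : ProjProd k n) : ∃ w, p ∈ stratum w := by
  obtain ⟨w, hw⟩ := exists_adapted (repMatrix_col_ne_zero p)
  exact ⟨w, mem_stratum_iff.2 hw⟩

lemma eq_of_mem_stratum {w w' : Fin n → Fin k} {p : ProjProd k n} (h : p ∈ stratum w)
    (h' : p ∈ stratum w') : w = w' :=
  (mem_stratum_iff.1 h).unique (mem_stratum_iff.1 h')

/-! ### Spanning configurations -/

lemma mem_spanningConfigs_iff {p : ProjProd k n} :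
    p ∈ spanningConfigs k n ↔ Submodule.span ℂ (Set.range (repMatrix p).col) = ⊤ := by
  rw [Submodule.span_range_eq_iSup]
  refine iff_of_eq (congrArg (· = ⊤) (iSup_congr fun j => ?_))
  exact Projectivization.submodule_eq (p j)

/-- Only nonvanishing pivots are assumed, not membership in the stratum; the paving needs this for
all of `pivotOpen w`. -/
lemma mem_spanningConfigs_of_surjective {w : Fin n → Fin k} (hw : Function.Surjective w)
    {p : ProjProd k n} (hp : ∀ j, coord w (repMatrix p) j (w j) ≠ 0) :
    p ∈ spanningConfigs k n := by
  rw [mem_spanningConfigs_iff, eq_top_iff]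
  intro v _
  have hd : (frame w (repMatrix p) n).det = 1 := det_frame n le_rfl fun i _ => hp i
  have hv : frame w (repMatrix p) n *ᵥ ((frame w (repMatrix p) n).adjugate *ᵥ v) = v := by
    rw [Matrix.mulVec_mulVec, Matrix.mul_adjugate, hd, one_smul, Matrix.one_mulVec]
  rw [← hv, Matrix.mulVec_eq_sum]
  refine Submodule.sum_mem _ fun r _ => ?_
  rw [op_smul_eq_smul]
  refine Submodule.smul_mem _ _ ?_
  exact col_frame_mem_span n le_rfl (fun i _ => hp i) r (seen_length.2 (hw r))

lemma surjective_of_mem_spanningConfigs {w : Fin n → Fin k} {p : ProjProd k n}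
    (hp : p ∈ stratum w) (hs : p ∈ spanningConfigs k n) : Function.Surjective w := by
  by_contra hw
  obtain ⟨a, ha⟩ : ∃ a, a ∉ Set.range w := by
    by_contra! h
    exact hw h
  obtain ⟨u, hu, B, hB, t, hA⟩ := mem_stratum_iff_factors.1 hp
  rw [eq_mul_diagonal_iff] at hA
  rw [mem_spanningConfigs_iff] at hs
  have hd : u.det = 1 := by
    rw [Matrix.det_of_isLowerTriangular _ fun r s hrs => hu.2.1 r s hrs]
    simp [hu.1]
  have hinv : ∀ x, u.adjugate *ᵥ (u *ᵥ x) = x := fun x => by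
    rw [Matrix.mulVec_mulVec, Matrix.adjugate_mul, hd, one_smul, Matrix.one_mulVec]
  -- This is row `a` of `u⁻¹`. Row `a` of `B` is zero for a missing letter `a`, so this nonzero
  -- functional kills every column.
  let φ : (Fin k → ℂ) →ₗ[ℂ] ℂ := LinearMap.proj a ∘ₗ u.adjugate.mulVecLin
  have hker : Submodule.span ℂ (Set.range (repMatrix p).col) ≤ LinearMap.ker φ := by
    rw [Submodule.span_le]
    rintro _ ⟨j, rfl⟩
    have hB0 : B a j = 0 := by
      refine (fitsPattern_iff.1 hB j).2 a (fun h => ha ⟨j, h.symm⟩) fun h => ha ?_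
      rw [← seen_length]
      by_cases hj : IsInitial w j
      · exact ((isStar_iff_of_isInitial hj a).1 h).1.mono j.2.le
      · exact ((isStar_iff_of_not_isInitial hj a).1 h).1.mono j.2.le
    simp [φ, hA, hinv, hB0]
  rw [hs] at hker
  have h1 : φ (u *ᵥ Pi.single a 1) = 0 := hker Submodule.mem_top
  simp only [φ, LinearMap.comp_apply, Matrix.mulVecLin_apply, hinv, LinearMap.proj_apply,
    Pi.single_eq_same] at h1
  exact one_ne_zero h1

lemma isFubini_iff_surjective (hk : 0 < k) {w : Fin n → Fin k} :
    IsFubini w ↔ Function.Surjective w := by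
  constructor
  · rintro ⟨h, j, hj⟩
    have : ∀ d : ℕ, ∀ a : Fin k, a.val + d + 1 = k → a ∈ Set.range w := by
      intro d
      induction d with
      | zero =>
        intro a ha
        exact ⟨j, Fin.ext (by omega)⟩
      | succ d ih =>
        intro a ha
        exact h a ⟨a + 1, by omega⟩ rfl (ih _ (by simp only; omega))
    intro a
    exact this (k - 1 - a) a (by omega)
  · intro h
    refine ⟨fun a _ _ _ => h a, ?_⟩
    obtain ⟨j, hj⟩ := h ⟨k - 1, by omega⟩
    refine ⟨j, ?_⟩
    rw [hj]
    exact Nat.sub_add_cancel hk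

lemma mem_spanningConfigs_iff_isFubini (hk : 0 < k) {w : Fin n → Fin k} {p : ProjProd k n}
    (hp : p ∈ stratum w) : p ∈ spanningConfigs k n ↔ IsFubini w := by
  rw [isFubini_iff_surjective hk]
  exact ⟨surjective_of_mem_spanningConfigs hp, fun h => mem_spanningConfigs_of_surjective h
    fun j => (mem_stratum_iff.1 hp j).1⟩

lemma pairwiseDisjoint_stratum (s : Set (Fin n → Fin k)) : s.PairwiseDisjoint stratum := by
  intro w _ w' _ hne
  rw [Function.onFun, Set.disjoint_left]
  exact fun p h h' => hne (eq_of_mem_stratum h h')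

lemma isDisjointUnion_stratum_univ :
    IsDisjointUnion Set.univ (fun w : Fin n → Fin k => stratum w) Set.univ := by
  refine ⟨pairwiseDisjoint_stratum _, Set.eq_univ_of_forall fun p => ?_⟩
  simpa using exists_mem_stratum p

lemma isDisjointUnion_stratum_isFubini (hk : 0 < k) :
    IsDisjointUnion {w : Fin n → Fin k | IsFubini w} (fun w : Fin n → Fin k => stratum w)
      (spanningConfigs k n) := by
  refine ⟨pairwiseDisjoint_stratum _, ?_⟩
  ext p
  simp only [Set.mem_iUnion, Set.mem_ofPred_eq, exists_prop]
  constructor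
  · rintro ⟨w, hw, hp⟩
    exact (mem_spanningConfigs_iff_isFubini hk hp).2 hw
  · intro hp
    obtain ⟨w, hw⟩ := exists_mem_stratum p
    exact ⟨w, (mem_spanningConfigs_iff_isFubini hk hw).1 hp, hw⟩

/-! ### Multihomogeneous fractions -/

/-- The value of a polynomial at a matrix. -/
noncomputable def evalMatrix (A : Matrix (Fin k) (Fin n) ℂ)
    (P : MvPolynomial (Fin k × Fin n) ℂ) : ℂ :=
  MvPolynomial.eval (fun ij : Fin k × Fin n => A ij.1 ij.2) P

lemma eval_eq_evalMatrix (p : ProjProd k n) (P : MvPolynomial (Fin k × Fin n) ℂ) :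
    p.eval P = evalMatrix (repMatrix p) P := rfl

lemma evalMatrix_mul_diagonal {P : MvPolynomial (Fin k × Fin n) ℂ} {d : Fin n → ℕ}
    (hP : IsMultihomogeneous P d) (A : Matrix (Fin k) (Fin n) ℂ) (s : Fin n → ℂ) :
    evalMatrix (A * Matrix.diagonal s) P = (∏ j, s j ^ d j) * evalMatrix A P := by
  unfold evalMatrix
  rw [MvPolynomial.eval_eq', MvPolynomial.eval_eq', Finset.mul_sum]
  refine Finset.sum_congr rfl fun m hm => ?_
  have hd := hP (MvPolynomial.mem_support_iff.1 hm)
  have hdj : ∀ j, d j = ∑ i, m (i, j) := by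
    intro j
    rw [← hd, Finsupp.weight_apply, Finsupp.sum_fintype _ _ (by simp), Finset.sum_apply,
      Fintype.sum_prod_type]
    refine Finset.sum_congr rfl fun i _ => ?_
    simp [Pi.single_apply]
  simp only [Matrix.mul_diagonal, mul_pow, Finset.prod_mul_distrib]
  have : ∏ x : Fin k × Fin n, s x.2 ^ m x = ∏ j, s j ^ d j := by
    rw [Fintype.prod_prod_type_right]
    refine Finset.prod_congr rfl fun j _ => ?_
    simp only [Finset.prod_pow_eq_pow_sum, hdj]
  rw [this]
  ring

lemma IsMultihomogeneous.mul_of_eq {P Q : MvPolynomial (Fin k × Fin n) ℂ} {a b c : Fin n → ℕ}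
    (hP : IsMultihomogeneous P a) (hQ : IsMultihomogeneous Q b) (h : a + b = c) :
    IsMultihomogeneous (P * Q) c :=
  h ▸ MvPolynomial.IsWeightedHomogeneous.mul hP hQ

/-- On the set `S`, the function `F` is a quotient of multihomogeneous polynomials whose
multidegrees differ by `d`. -/
def IsFraction (S : Set (Matrix (Fin k) (Fin n) ℂ)) (d : Fin n → ℕ)
    (F : Matrix (Fin k) (Fin n) ℂ → ℂ) : Prop :=
  ∃ (P Q : MvPolynomial (Fin k × Fin n) ℂ) (e : Fin n → ℕ),
    IsMultihomogeneous P (e + d) ∧ IsMultihomogeneous Q e ∧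
    ∀ A ∈ S, evalMatrix A Q ≠ 0 ∧ F A = evalMatrix A P / evalMatrix A Q

namespace IsFraction

variable {S T : Set (Matrix (Fin k) (Fin n) ℂ)} {d e : Fin n → ℕ}
  {F G : Matrix (Fin k) (Fin n) ℂ → ℂ}

lemma mono (h : IsFraction S d F) (hT : T ⊆ S) : IsFraction T d F := by
  obtain ⟨P, Q, e, hP, hQ, hS⟩ := h
  exact ⟨P, Q, e, hP, hQ, fun A hA => hS A (hT hA)⟩

lemma congr (h : IsFraction S d F) (hG : ∀ A ∈ S, G A = F A) : IsFraction S d G := by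
  obtain ⟨P, Q, e, hP, hQ, hS⟩ := h
  exact ⟨P, Q, e, hP, hQ, fun A hA => ⟨(hS A hA).1, (hG A hA).trans (hS A hA).2⟩⟩

lemma of_polynomial {P : MvPolynomial (Fin k × Fin n) ℂ} (hP : IsMultihomogeneous P d) :
    IsFraction S d fun A => evalMatrix A P :=
  ⟨P, 1, 0, by rwa [zero_add], MvPolynomial.isWeightedHomogeneous_one _ _, fun A _ => by
    simp [evalMatrix]⟩

lemma const (c : ℂ) : IsFraction S (0 : Fin n → ℕ) fun _ : Matrix (Fin k) (Fin n) ℂ => c :=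
  (of_polynomial (MvPolynomial.isWeightedHomogeneous_C _ c)).congr fun A _ => by simp [evalMatrix]

lemma entry (i : Fin k) (j : Fin n) :
    IsFraction S (Pi.single j 1 : Fin n → ℕ) fun A : Matrix (Fin k) (Fin n) ℂ => A i j :=
  (of_polynomial (MvPolynomial.isWeightedHomogeneous_X _ _ (i, j))).congr fun A _ => by
    simp [evalMatrix]

lemma add (hF : IsFraction S d F) (hG : IsFraction S d G) :
    IsFraction S d fun A => F A + G A := by
  obtain ⟨P, Q, e, hP, hQ, h⟩ := hF
  obtain ⟨P', Q', e', hP', hQ', h'⟩ := hG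
  refine ⟨P * Q' + Q * P', Q * Q', e + e', ?_, hQ.mul hQ', fun A hA => ?_⟩
  · exact MvPolynomial.IsWeightedHomogeneous.add (hP.mul_of_eq hQ' (by ring))
      (hQ.mul_of_eq hP' (by ring))
  · have h1 := (h A hA).1
    have h2 := (h' A hA).1
    beta_reduce
    rw [(h A hA).2, (h' A hA).2, div_add_div _ _ h1 h2]
    unfold evalMatrix at *
    simp only [map_add, map_mul]
    exact ⟨mul_ne_zero h1 h2, trivial⟩

lemma mul (hF : IsFraction S d F) (hG : IsFraction S e G) :
    IsFraction S (d + e) fun A => F A * G A := by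
  obtain ⟨P, Q, a, hP, hQ, h⟩ := hF
  obtain ⟨P', Q', a', hP', hQ', h'⟩ := hG
  refine ⟨P * P', Q * Q', a + a', ?_, hQ.mul hQ', fun A hA => ?_⟩
  · exact hP.mul_of_eq hP' (by ring)
  · have h1 := (h A hA).1
    have h2 := (h' A hA).1
    beta_reduce
    rw [(h A hA).2, (h' A hA).2, div_mul_div_comm]
    unfold evalMatrix at *
    simp only [map_mul]
    exact ⟨mul_ne_zero h1 h2, trivial⟩

lemma div (hF : IsFraction S d F) (hG : IsFraction S d G) (h0 : ∀ A ∈ S, G A ≠ 0) :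
    IsFraction S 0 fun A => F A / G A := by
  obtain ⟨P, Q, a, hP, hQ, h⟩ := hF
  obtain ⟨P', Q', a', hP', hQ', h'⟩ := hG
  refine ⟨P * Q', Q * P', a + a' + d, ?_, ?_, fun A hA => ?_⟩
  · exact hP.mul_of_eq hQ' (by ring)
  · exact hQ.mul_of_eq hP' (by ring)
  · have h1 := (h A hA).1
    have h2 := h0 A hA
    rw [(h' A hA).2] at h2
    beta_reduce
    rw [(h A hA).2, (h' A hA).2, div_div_div_eq]
    unfold evalMatrix at *
    simp only [map_mul]
    exact ⟨mul_ne_zero h1 (div_ne_zero_iff.1 h2).1, trivial⟩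

lemma sum {ι : Type*} {s : Finset ι} {f : ι → Matrix (Fin k) (Fin n) ℂ → ℂ}
    (h : ∀ i ∈ s, IsFraction S d (f i)) : IsFraction S d fun A => ∑ i ∈ s, f i A := by
  classical
  induction s using Finset.induction_on with
  | empty =>
    exact (of_polynomial (MvPolynomial.isWeightedHomogeneous_zero _ _ d)).congr fun A _ => by
      simp [evalMatrix]
  | insert i s hi ih =>
    simp only [Finset.sum_insert hi]
    exact (h i (Finset.mem_insert_self _ _)).add
      (ih fun j hj => h j (Finset.mem_insert_of_mem hj))

lemma prod {ι : Type*} {s : Finset ι} {f : ι → Matrix (Fin k) (Fin n) ℂ → ℂ}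
    (h : ∀ i ∈ s, IsFraction S 0 (f i)) : IsFraction S 0 fun A => ∏ i ∈ s, f i A := by
  classical
  induction s using Finset.induction_on with
  | empty => simpa using const 1
  | insert i s hi ih =>
    simp only [Finset.prod_insert hi]
    simpa using (h i (Finset.mem_insert_self _ _)).mul
      (ih fun j hj => h j (Finset.mem_insert_of_mem hj))

lemma det {m : ℕ} {M : Matrix (Fin k) (Fin n) ℂ → Matrix (Fin m) (Fin m) ℂ}
    (h : ∀ r s, IsFraction S 0 fun A => M A r s) : IsFraction S 0 fun A => (M A).det := by
  simp only [Matrix.det_apply']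
  refine sum fun σ _ => ?_
  simpa using (const _).mul (prod fun i _ => h (σ i) i)

lemma adjugate {m : ℕ} {M : Matrix (Fin k) (Fin n) ℂ → Matrix (Fin m) (Fin m) ℂ}
    (h : ∀ r s, IsFraction S 0 fun A => M A r s) (r s : Fin m) :
    IsFraction S 0 fun A => (M A).adjugate r s := by
  simp only [Matrix.adjugate_apply]
  refine det fun r' s' => ?_
  simp only [Matrix.updateRow_apply]
  split_ifs
  · exact const _
  · exact h r' s'

lemma mulVec {m : ℕ} {M : Matrix (Fin k) (Fin n) ℂ → Matrix (Fin m) (Fin m) ℂ}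
    {x : Matrix (Fin k) (Fin n) ℂ → Fin m → ℂ} (hM : ∀ r s, IsFraction S 0 fun A => M A r s)
    (hx : ∀ s, IsFraction S d fun A => x A s) (r : Fin m) :
    IsFraction S d fun A => (M A *ᵥ x A) r := by
  simp only [Matrix.mulVec, dotProduct]
  refine sum fun s _ => ?_
  simpa using (hM r s).mul (hx s)

lemma aeval {σ : Type*} {f : σ → Matrix (Fin k) (Fin n) ℂ → ℂ} (h : ∀ i, IsFraction S 0 (f i))
    (P : MvPolynomial σ ℂ) : IsFraction S 0 fun A => MvPolynomial.eval (fun i => f i A) P := by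
  induction P using MvPolynomial.induction_on with
  | C c => simpa using const c
  | add P Q hP hQ => simpa using hP.add hQ
  | mul_X P i hP => simpa using hP.mul (h i)

end IsFraction

/-! ### The locus where the pivots do not vanish -/

/-- The matrices whose first `j` pivots for the word `w` do not vanish. -/
def pivotLocus (w : Fin n → Fin k) (j : ℕ) : Set (Matrix (Fin k) (Fin n) ℂ) :=
  {A | ∀ i : Fin n, i.val < j → coord w A i (w i) ≠ 0}

lemma pivotLocus_anti (w : Fin n → Fin k) {i j : ℕ} (h : i ≤ j) :
    pivotLocus w j ⊆ pivotLocus w i :=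
  fun _ hA a ha => hA a (ha.trans_le h)

lemma mem_pivotLocus_succ {w : Fin n → Fin k} {A : Matrix (Fin k) (Fin n) ℂ} {j : Fin n} :
    A ∈ pivotLocus w (j + 1) ↔ A ∈ pivotLocus w j ∧ coord w A j (w j) ≠ 0 := by
  constructor
  · exact fun h => ⟨pivotLocus_anti w (Nat.le_succ _) h, h j (Nat.lt_succ_self _)⟩
  · rintro ⟨h1, h2⟩ i hi
    rcases Nat.lt_succ_iff_lt_or_eq.1 hi with hi | hi
    · exact h1 i hi
    · rwa [Fin.ext hi]

lemma isFraction_coord_of_frame {w : Fin n → Fin k} {j : Fin n}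
    (h : ∀ r s, IsFraction (pivotLocus w j) 0 fun A => frame w A j r s) (r : Fin k) :
    IsFraction (pivotLocus w j) (Pi.single j 1) fun A => coord w A j r :=
  IsFraction.mulVec (IsFraction.adjugate h) (fun s => IsFraction.entry s j) r

/-- The only divisions in the elimination are by earlier pivots. The new column is a ratio of
coordinates of one column, so it has multidegree 0. -/
lemma isFraction_frame (w : Fin n → Fin k) :
    ∀ j ≤ n, ∀ r s, IsFraction (pivotLocus w j) 0 fun A => frame w A j r s := by
  apply position_induction
  · intro r s
    exact IsFraction.const _
  · intro j ih r s
    have hsub := pivotLocus_anti w (Nat.le_succ j)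
    by_cases h1 : Seen w j (w j)
    · simp only [frame_succ_of_seen _ h1]
      exact (ih r s).mono hsub
    · simp only [frame_succ_of_not_seen _ h1, Matrix.updateCol_apply]
      split_ifs
      · refine IsFraction.mulVec (fun r s => (ih r s).mono hsub) (fun s => ?_) r
        unfold elimCol
        split_ifs
        · exact IsFraction.const 0
        · exact ((isFraction_coord_of_frame ih s).mono hsub).div
            ((isFraction_coord_of_frame ih (w j)).mono hsub) fun A hA => (mem_pivotLocus_succ.1 hA).2
      · exact (ih r s).mono hsub

lemma isFraction_coord (w : Fin n → Fin k) (j : Fin n) (r : Fin k) :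
    IsFraction (pivotLocus w j) (Pi.single j 1) fun A => coord w A j r :=
  isFraction_coord_of_frame (isFraction_frame w j j.2.le) r

lemma isOpen_eval_ne_zero {P : MvPolynomial (Fin k × Fin n) ℂ} {d : Fin n → ℕ}
    (hP : IsMultihomogeneous P d) : IsOpen {p : ProjProd k n | p.eval P ≠ 0} :=
  TopologicalSpace.isOpen_generateFrom_of_mem ⟨P, d, hP, rfl⟩

/-- The numerator of a fraction on `S` vanishes at the same points of `S` as the fraction. -/
lemma IsFraction.exists_isOpen {S : Set (Matrix (Fin k) (Fin n) ℂ)} {d : Fin n → ℕ}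
    {F : Matrix (Fin k) (Fin n) ℂ → ℂ} (h : IsFraction S d F) :
    ∃ O : Set (ProjProd k n), IsOpen O ∧
      ∀ p, repMatrix p ∈ S → (p ∈ O ↔ F (repMatrix p) ≠ 0) := by
  obtain ⟨P, Q, e, hP, hQ, hS⟩ := h
  refine ⟨_, isOpen_eval_ne_zero hP, fun p hp => ?_⟩
  rw [(hS _ hp).2, Set.mem_ofPred_eq, eval_eq_evalMatrix]
  simp [(hS _ hp).1]

/-- The `j`-th pivot is a fraction only where the earlier pivots are nonzero, so openness is proved
one position at a time. -/
lemma isOpen_pivotLocus (w : Fin n → Fin k) :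
    ∀ j ≤ n, IsOpen {p : ProjProd k n | repMatrix p ∈ pivotLocus w j} := by
  apply position_induction
  · convert isOpen_univ
    ext p
    simp [pivotLocus]
  · intro j ih
    obtain ⟨O, hO, h⟩ := (isFraction_coord w j (w j)).exists_isOpen
    convert ih.inter hO using 1
    ext p
    simp only [Set.mem_ofPred_eq, Set.mem_inter_iff, mem_pivotLocus_succ]
    exact and_congr_right fun hp => (h p hp).symm

/-- The open set of the configurations all of whose pivots for the word `w` are nonzero. -/
def pivotOpen (w : Fin n → Fin k) : Set (ProjProd k n) :=
  {p | repMatrix p ∈ pivotLocus w n}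

lemma isOpen_pivotOpen (w : Fin n → Fin k) : IsOpen (pivotOpen w) :=
  isOpen_pivotLocus w n le_rfl

lemma stratum_subset_pivotOpen (w : Fin n → Fin k) : stratum w ⊆ pivotOpen w :=
  fun _ hp i _ => (mem_stratum_iff.1 hp i).1

/-! ### The paving -/

/-- The keys of the letters of a word, compared lexicographically. -/
noncomputable def lexKey (w : Fin n → Fin k) : Lex (Fin n → ℕ) :=
  toLex fun j => key w j (w j)

lemma exists_first_difference {w w' : Fin n → Fin k} (h : w ≠ w') :
    ∃ j, w j ≠ w' j ∧ ∀ i < j, w i = w' i := by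
  obtain ⟨j, hj, hmin⟩ := WellFounded.has_min (wellFounded_lt (α := Fin n)) {j | w j ≠ w' j}
    (Function.ne_iff.1 h)
  exact ⟨j, hj, fun i hi => by
    by_contra h'
    exact hmin i h' hi⟩

lemma lexKey_injective : Function.Injective (lexKey : (Fin n → Fin k) → _) := by
  intro w w' h
  by_contra hne
  obtain ⟨j, hj, hlt⟩ := exists_first_difference hne
  have := congrFun (toLex.injective h) j
  simp only [key_congr hlt] at this
  exact hj (key_injective w' j this)

/-- At the first difference the two words still see the same coordinates; the one at `w j` is
nonzero, and `w' j` has the largest key among the nonzero ones. -/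
lemma lexKey_le_of_mem_pivotOpen {w w' : Fin n → Fin k} {p : ProjProd k n}
    (hp : p ∈ pivotOpen w) (hp' : p ∈ stratum w') : lexKey w ≤ lexKey w' := by
  rcases eq_or_ne w w' with rfl | hne
  · exact le_rfl
  · obtain ⟨j, hj, hlt⟩ := exists_first_difference hne
    refine le_of_lt ⟨j, fun i hi => ?_, ?_⟩
    · change key w i (w i) = key w' i (w' i)
      rw [key_congr (fun a ha => hlt a (ha.trans hi)), hlt i hi]
    · change key w j (w j) < key w' j (w' j)
      rw [key_congr hlt]
      refine lt_of_le_of_ne ((mem_stratum_iff.1 hp' j).2 _ ?_) fun h => hj (key_injective w' j h)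
      rw [← coord_congr _ hlt]
      exact hp j j.2

open Classical in
/-- The lexicographic order refined such that the Fubini words come last. -/
noncomputable def pavingKey (w : Fin n → Fin k) : ℕ ×ₗ Lex (Fin n → ℕ) :=
  toLex (if IsFubini w then 1 else 0, lexKey w)

lemma pavingKey_injective : Function.Injective (pavingKey : (Fin n → Fin k) → _) :=
  fun _ _ h => lexKey_injective (congrArg Prod.snd (toLex.injective h))

lemma pavingKey_le_of_mem_pivotOpen (hk : 0 < k) {w w' : Fin n → Fin k} {p : ProjProd k n}
    (hp : p ∈ pivotOpen w) (hp' : p ∈ stratum w') : pavingKey w ≤ pavingKey w' := by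
  -- Nonzero pivots for a surjective word force spanning, and spanning forces the actual word to be
  -- Fubini.
  have h : IsFubini w → IsFubini w' := fun h =>
    (mem_spanningConfigs_iff_isFubini hk hp').1 <| mem_spanningConfigs_of_surjective
      ((isFubini_iff_surjective hk).1 h) fun j => hp j j.2
  rw [pavingKey, pavingKey, Prod.Lex.toLex_le_toLex]
  have hle := lexKey_le_of_mem_pivotOpen hp hp'
  by_cases h1 : IsFubini w
  · simp [h1, h h1, hle]
  · by_cases h2 : IsFubini w'
    · simp [h1, h2]
    · simp [h1, h2, hle]

lemma isFubini_of_pavingKey_le {w w' : Fin n → Fin k} (h : pavingKey w ≤ pavingKey w')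
    (hw : IsFubini w) : IsFubini w' := by
  by_contra h'
  rw [pavingKey, pavingKey, Prod.Lex.toLex_le_toLex] at h
  simp [hw, h'] at h

lemma exists_equiv_fin_of_injective {α β : Type*} [Finite α] [LinearOrder β] {f : α → β}
    (hf : Function.Injective f) :
    ∃ (m : ℕ) (e : α ≃ Fin m), ∀ a b, e a ≤ e b ↔ f a ≤ f b := by
  cases nonempty_fintype α
  let _ : LinearOrder α := LinearOrder.lift' f hf
  exact ⟨_, (Fintype.orderIsoFinOfCardEq α rfl).symm.toEquiv,
    fun a b => (Fintype.orderIsoFinOfCardEq α rfl).symm.le_iff_le⟩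

lemma exists_threshold {m : ℕ} {U : Fin m → Prop} (hU : ∀ i j, i ≤ j → U i → U j) :
    ∃ i₀ : Fin (m + 1), ∀ i : Fin m, U i ↔ i₀.val ≤ i.val := by
  by_cases h : ∃ i, U i
  · obtain ⟨i, hi, hmin⟩ := WellFounded.has_min (wellFounded_lt (α := Fin m)) {i | U i} h
    refine ⟨i.castSucc, fun j => ⟨fun hj => ?_, fun hj => hU i j hj hi⟩⟩
    exact Fin.le_def.1 (not_lt.1 (hmin j hj))
  · refine ⟨Fin.last m, fun i => iff_of_false (fun hi => h ⟨i, hi⟩) ?_⟩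
    rw [Fin.val_last]
    exact not_le.2 i.2

lemma stratum_nonempty (w : Fin n → Fin k) : (stratum w).Nonempty := by
  let A : Matrix (Fin k) (Fin n) ℂ := Matrix.of fun r j => (Pi.single (w j) 1 : Fin k → ℂ) r
  have hcol : ∀ j, A.col j ≠ 0 := fun j h => by
    have := congrFun h (w j)
    simp [A] at this
  refine ⟨ofMatrix _ hcol, _, hcol, rfl, 1, ⟨by simp, fun i j h => by simp [h.ne],
    fun i j h _ => by simp [h.ne']⟩, A, ?_, 1, ?_⟩
  · rw [fitsPattern_iff]
    exact fun j => ⟨by simp [A], fun r h _ => by simp [A, h]⟩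
  · simp

lemma exists_isAffinePaving (hk : 0 < k)
    (hcell : ∀ w : Fin n → Fin k, ∃ d, IsAffineSpaceOfDim (stratum w) d) :
    ∃ (m : ℕ) (Z : Fin (m + 1) → Set (ProjProd k n)),
      IsAffinePaving (fun w : Fin n → Fin k => stratum w) Z ∧
      ∃ i : Fin (m + 1), spanningConfigs k n = Set.univ \ Z i := by
  obtain ⟨m, e, he⟩ := exists_equiv_fin_of_injective (pavingKey_injective (k := k) (n := n))
  let Z : Fin (m + 1) → Set (ProjProd k n) := fun i => {p | ∀ w, p ∈ stratum w → (e w).val < i.val}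
  have hZ : ∀ {p w}, p ∈ stratum w → ∀ i, p ∈ Z i ↔ (e w).val < i.val := by
    intro p w hp i
    refine ⟨fun h => h w hp, fun h w' hp' => ?_⟩
    rwa [eq_of_mem_stratum hp' hp]
  have hdiff : ∀ i : Fin m, Z i.succ \ Z i.castSucc = stratum (e.symm i) := by
    intro i
    ext p
    obtain ⟨w, hw⟩ := exists_mem_stratum p
    rw [Set.mem_sdiff, hZ hw, hZ hw, Fin.val_succ, Fin.val_castSucc]
    constructor
    · intro h
      have : e w = i := Fin.ext (by omega)
      rwa [← this, e.symm_apply_apply]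
    · intro h
      rw [eq_of_mem_stratum hw h, e.apply_symm_apply]
      omega
  refine ⟨m, Z, ⟨fun i => ?_, fun i j hij => ?_, ?_, ?_, e, fun i => ⟨⟨?_, ?_⟩, ?_⟩⟩, ?_⟩
  · rw [← isOpen_compl_iff]
    -- A set `pivotOpen w` meets only strata of rank at least that of `w`, so enlarging strata to
    -- these open sets does not change the union.
    have : (Z i)ᶜ = ⋃ (w : Fin n → Fin k) (_ : i.val ≤ (e w).val), pivotOpen w := by
      ext p
      obtain ⟨w, hw⟩ := exists_mem_stratum p
      simp only [Set.mem_compl_iff, hZ hw, not_lt, Set.mem_iUnion, exists_prop]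
      constructor
      · exact fun h => ⟨w, h, stratum_subset_pivotOpen w hw⟩
      · rintro ⟨w', h, hp⟩
        exact h.trans ((he _ _).2 (pavingKey_le_of_mem_pivotOpen hk hp hw))
    rw [this]
    exact isOpen_iUnion fun w => isOpen_iUnion fun _ => isOpen_pivotOpen w
  · have hij : i.val < j.val := hij
    have hi : i.val < m := by have := j.2; omega
    refine ⟨fun p hp w hw => (hp w hw).trans hij, fun h => ?_⟩
    obtain ⟨p, hp⟩ := stratum_nonempty (e.symm ⟨i, hi⟩)
    have h1 : p ∈ Z j := by
      rw [hZ hp, e.apply_symm_apply]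
      exact hij
    have h2 := (hZ hp i).1 (h h1)
    rw [e.apply_symm_apply] at h2
    exact lt_irrefl _ h2
  · ext p
    obtain ⟨w, hw⟩ := exists_mem_stratum p
    rw [hZ hw]
    simp
  · ext p
    obtain ⟨w, hw⟩ := exists_mem_stratum p
    rw [hZ hw]
    simp
  · exact pairwiseDisjoint_stratum _
  · rw [hdiff]
    ext p
    simp only [Set.mem_iUnion, Set.mem_ofPred_eq, exists_prop]
    constructor
    · rintro ⟨w, rfl, hp⟩
      rwa [e.symm_apply_apply]
    · exact fun hp => ⟨_, e.apply_symm_apply i, hp⟩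
  · rintro w rfl
    refine ⟨⟨Set.univ, isOpen_univ, ?_⟩, hcell w⟩
    rw [hdiff, e.symm_apply_apply, Set.univ_inter]
  -- Fubini words form a final segment of the ranking; its starting rank cuts off the non-spanning
  -- configurations.
  · obtain ⟨i₀, hi₀⟩ := exists_threshold (U := fun i => IsFubini (e.symm i)) fun i j hij h =>
      isFubini_of_pavingKey_le ((he _ _).1 (by simpa using hij)) h
    refine ⟨i₀, ?_⟩
    ext p
    obtain ⟨w, hw⟩ := exists_mem_stratum p
    rw [mem_spanningConfigs_iff_isFubini hk hw, Set.mem_sdiff, hZ hw, not_lt, ← hi₀,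
      e.symm_apply_apply]
    simp

/-! ### Coordinates on a stratum -/

/-- The stars of the pattern matrix of `w` and the free entries of the matrices in `U_k(w)`. -/
abbrev CellIndex (w : Fin n → Fin k) : Type :=
  {rj : Fin k × Fin n // IsStar w rj.1 rj.2} ⊕
    {rs : Fin k × Fin k // rs.2 < rs.1 ∧ rs.2 ∈ Set.range w}

open Classical in
/-- The matrices with arbitrary entries below the diagonal in the columns indexed by letters of
`w`, and zeros elsewhere. -/
noncomputable def lowerPart (w : Fin n → Fin k) :
    ({rs : Fin k × Fin k // rs.2 < rs.1 ∧ rs.2 ∈ Set.range w} → ℂ) →ₗ[ℂ]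
      Matrix (Fin k) (Fin k) ℂ where
  toFun x := Matrix.of fun r s => if h : s < r ∧ s ∈ Set.range w then x ⟨(r, s), h⟩ else 0
  map_add' x y := by
    ext r s
    simp only [Matrix.of_apply, Matrix.add_apply, Pi.add_apply]
    split_ifs <;> simp
  map_smul' c x := by
    ext r s
    simp only [Matrix.of_apply, Matrix.smul_apply, Pi.smul_apply, RingHom.id_apply]
    split_ifs <;> simp

lemma lowerPart_apply_of_mem {w : Fin n → Fin k}
    (x : {rs : Fin k × Fin k // rs.2 < rs.1 ∧ rs.2 ∈ Set.range w} → ℂ) {r s : Fin k}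
    (h : s < r ∧ s ∈ Set.range w) : lowerPart w x r s = x ⟨(r, s), h⟩ :=
  dif_pos h

lemma lowerPart_apply_of_not_mem {w : Fin n → Fin k}
    (x : {rs : Fin k × Fin k // rs.2 < rs.1 ∧ rs.2 ∈ Set.range w} → ℂ) {r s : Fin k}
    (h : ¬ (s < r ∧ s ∈ Set.range w)) : lowerPart w x r s = 0 :=
  dif_neg h

lemma lowerPart_injective (w : Fin n → Fin k) : Function.Injective (lowerPart w) := by
  intro x y h
  funext rs
  rw [← lowerPart_apply_of_mem x rs.2, h, lowerPart_apply_of_mem]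

lemma mem_unipotent_iff {w : Fin n → Fin k} {u : Matrix (Fin k) (Fin k) ℂ} :
    u ∈ unipotent w ↔ ∃ x, u = 1 + lowerPart w x := by
  constructor
  · rintro ⟨h1, h2, h3⟩
    refine ⟨fun rs => u rs.1.1 rs.1.2, ?_⟩
    ext r s
    rw [Matrix.add_apply]
    by_cases h : s < r ∧ s ∈ Set.range w
    · rw [lowerPart_apply_of_mem _ h, Matrix.one_apply_ne h.1.ne', zero_add]
    · rw [lowerPart_apply_of_not_mem _ h, add_zero]
      rcases lt_trichotomy r s with hrs | rfl | hrs
      · rw [h2 r s hrs, Matrix.one_apply_ne hrs.ne]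
      · rw [h1, Matrix.one_apply_eq]
      · rw [h3 r s hrs fun hs => h ⟨hrs, hs⟩, Matrix.one_apply_ne hrs.ne']
  · rintro ⟨x, rfl⟩
    refine ⟨fun r => ?_, fun r s h => ?_, fun r s h hs => ?_⟩
    · rw [Matrix.add_apply, lowerPart_apply_of_not_mem _ fun h => lt_irrefl _ h.1,
        Matrix.one_apply_eq, add_zero]
    · rw [Matrix.add_apply, lowerPart_apply_of_not_mem _ fun h' => lt_asymm h h'.1,
        Matrix.one_apply_ne h.ne, add_zero]
    · rw [Matrix.add_apply, lowerPart_apply_of_not_mem _ fun h' => hs h'.2,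
        Matrix.one_apply_ne h.ne', add_zero]

lemma vectorSpan_unipotent (w : Fin n → Fin k) :
    vectorSpan ℂ (unipotent w) = LinearMap.range (lowerPart w) := by
  have h1 : (1 : Matrix (Fin k) (Fin k) ℂ) ∈ unipotent w := mem_unipotent_iff.2 ⟨0, by simp⟩
  rw [vectorSpan_eq_span_vsub_set_right ℂ h1]
  have : (fun u : Matrix (Fin k) (Fin k) ℂ => u -ᵥ (1 : Matrix (Fin k) (Fin k) ℂ)) '' unipotent w =
      LinearMap.range (lowerPart w) := by
    ext v
    constructor
    · rintro ⟨u, hu, rfl⟩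
      obtain ⟨x, rfl⟩ := mem_unipotent_iff.1 hu
      exact ⟨x, by simp⟩
    · rintro ⟨x, rfl⟩
      exact ⟨1 + lowerPart w x, mem_unipotent_iff.2 ⟨x, rfl⟩, by simp⟩
  rw [this, Submodule.span_eq]

lemma card_cellIndex (w : Fin n → Fin k) :
    Nat.card (CellIndex w) = numStars w + dimUnipotent w := by
  classical
  rw [Nat.card_sum]
  congr 1
  · unfold numStars
    simp only [patternMatrix_eq_star]
    rfl
  · rw [dimUnipotent, vectorSpan_unipotent, LinearMap.finrank_range_of_inj (lowerPart_injective w),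
      Module.finrank_fintype_fun_eq_card, Nat.card_eq_fintype_card]

/-! ### Matrices with prescribed coordinates -/

open Classical in
/-- The matrix that arises from the pattern matrix by filling in the coordinates `y`. -/
noncomputable def fillPattern (w : Fin n → Fin k) (y : CellIndex w → ℂ) :
    Matrix (Fin k) (Fin n) ℂ :=
  Matrix.of fun r j => if r = w j then 1 else
    if h : IsStar w r j then y (.inl ⟨(r, j), h⟩) else 0

lemma fillPattern_self (w : Fin n → Fin k) (y : CellIndex w → ℂ) (j : Fin n) :
    fillPattern w y (w j) j = 1 :=
  if_pos rfl

lemma fillPattern_of_isStar {w : Fin n → Fin k} (y : CellIndex w → ℂ) {r : Fin k} {j : Fin n}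
    (h : IsStar w r j) : fillPattern w y r j = y (.inl ⟨(r, j), h⟩) := by
  have hr : r ≠ w j := by
    rintro rfl
    exact not_isStar_self w j h
  simp [fillPattern, hr, h]

lemma fillPattern_of_not_isStar {w : Fin n → Fin k} (y : CellIndex w → ℂ) {r : Fin k} {j : Fin n}
    (hr : r ≠ w j) (h : ¬ IsStar w r j) : fillPattern w y r j = 0 := by
  simp [fillPattern, hr, h]

lemma fitsPattern_fillPattern (w : Fin n → Fin k) (y : CellIndex w → ℂ) :
    FitsPattern w (fillPattern w y) :=
  fitsPattern_iff.2 fun j => ⟨fillPattern_self w y j, fun _ hr h => fillPattern_of_not_isStar y hr h⟩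

/-- The element of `U_k(w)` with coordinates `y`. -/
noncomputable def fillUnipotent (w : Fin n → Fin k) (y : CellIndex w → ℂ) :
    Matrix (Fin k) (Fin k) ℂ :=
  1 + lowerPart w (y ∘ Sum.inr)

lemma fillUnipotent_mem (w : Fin n → Fin k) (y : CellIndex w → ℂ) :
    fillUnipotent w y ∈ unipotent w :=
  mem_unipotent_iff.2 ⟨_, rfl⟩

lemma exists_fill {w : Fin n → Fin k} {u : Matrix (Fin k) (Fin k) ℂ} (hu : u ∈ unipotent w)
    {B : Matrix (Fin k) (Fin n) ℂ} (hB : FitsPattern w B) :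
    ∃ y, u = fillUnipotent w y ∧ B = fillPattern w y := by
  obtain ⟨x, rfl⟩ := mem_unipotent_iff.1 hu
  refine ⟨Sum.elim (fun rj => B rj.1.1 rj.1.2) x, rfl, ?_⟩
  ext r j
  by_cases hr : r = w j
  · subst hr
    rw [fillPattern_self, (fitsPattern_iff.1 hB j).1]
  · by_cases h : IsStar w r j
    · rw [fillPattern_of_isStar _ h, Sum.elim_inl]
    · rw [fillPattern_of_not_isStar _ hr h, (fitsPattern_iff.1 hB j).2 r hr h]

/-- The matrix with coordinates `y`. -/
noncomputable def cellMatrix (w : Fin n → Fin k) (y : CellIndex w → ℂ) :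
    Matrix (Fin k) (Fin n) ℂ :=
  fillUnipotent w y * fillPattern w y

/-- The coordinates of a matrix adapted to `w`. -/
noncomputable def cellCoord (w : Fin n → Fin k) (A : Matrix (Fin k) (Fin n) ℂ) :
    CellIndex w → ℂ
  | .inl rj => coord w A rj.1.2 rj.1.1 / coord w A rj.1.2 (w rj.1.2)
  | .inr rs => frame w A n rs.1.1 rs.1.2

/-- The diagonal factor allows for the arbitrary representatives of the lines; the coordinates do
not see it. -/
lemma cellCoord_cellMatrix_mul_diagonal (w : Fin n → Fin k) (y : CellIndex w → ℂ)
    {t : Fin n → ℂ} (ht : ∀ j, t j ≠ 0) :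
    cellCoord w (cellMatrix w y * Matrix.diagonal t) = y := by
  have hu := fillUnipotent_mem w y
  have hB := fitsPattern_fillPattern w y
  funext i
  rcases i with rj | rs
  · have h := coord_of_factors hu hB ht rfl rj.1.2
    have h0 := ht rj.1.2
    rw [cellCoord, cellMatrix, h.1, h.2.1 _ rj.2, fillPattern_of_isStar y rj.2]
    field_simp
  · rw [cellCoord, cellMatrix, frame_of_factors hu hB ht rfl n le_rfl,
      partialFrame_apply_of_seen _ (seen_length.2 rs.2.2), fillUnipotent, Matrix.add_apply,
      Matrix.one_apply_ne rs.2.1.ne', zero_add, lowerPart_apply_of_mem _ rs.2]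
    rfl

lemma factors_cellMatrix (w : Fin n → Fin k) (y : CellIndex w → ℂ) :
    Factors w (cellMatrix w y) :=
  ⟨_, fillUnipotent_mem w y, _, fitsPattern_fillPattern w y, 1, by simp [cellMatrix]⟩

lemma Factors.exists_eq_cellMatrix {w : Fin n → Fin k} {A : Matrix (Fin k) (Fin n) ℂ}
    (h : Factors w A) :
    ∃ t : Fin n → ℂˣ, A = cellMatrix w (cellCoord w A) * Matrix.diagonal fun j => (t j : ℂ) := by
  obtain ⟨u, hu, B, hB, t, hA⟩ := h
  obtain ⟨y, rfl, rfl⟩ := exists_fill hu hB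
  change A = cellMatrix w y * _ at hA
  refine ⟨t, ?_⟩
  have : cellCoord w A = y := by
    rw [hA]
    exact cellCoord_cellMatrix_mul_diagonal w y fun j => (t j).ne_zero
  rw [this]
  exact hA

lemma cellMatrix_col_ne_zero (w : Fin n → Fin k) (y : CellIndex w → ℂ) (j : Fin n) :
    (cellMatrix w y).col j ≠ 0 := by
  intro h
  have := (factors_iff_adapted.1 (factors_cellMatrix w y) j).1
  rw [coord, h, Matrix.mulVec_zero] at this
  exact this rfl

lemma ofMatrix_cellMatrix_mem (w : Fin n → Fin k) (y : CellIndex w → ℂ) :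
    ofMatrix (cellMatrix w y) (cellMatrix_col_ne_zero w y) ∈ stratum w :=
  ⟨_, _, rfl, factors_cellMatrix w y⟩

lemma ofMatrix_eq_of_mul_diagonal {A A' : Matrix (Fin k) (Fin n) ℂ} (hA : ∀ j, A.col j ≠ 0)
    (hA' : ∀ j, A'.col j ≠ 0) {t : Fin n → ℂˣ}
    (h : A' = A * Matrix.diagonal fun j => (t j : ℂ)) : ofMatrix A hA = ofMatrix A' hA' := by
  funext j
  refine (Projectivization.mk_eq_mk_iff ℂ _ _ (hA j) (hA' j)).2 ⟨(t j)⁻¹, ?_⟩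
  rw [inv_smul_eq_iff, h]
  ext i
  rw [Matrix.col_apply, Matrix.mul_diagonal, mul_comm]
  rfl

lemma isFraction_cellCoord (w : Fin n → Fin k) (i : CellIndex w) :
    IsFraction (pivotLocus w n) 0 fun A => cellCoord w A i := by
  rcases i with rj | rs
  · have hsub := pivotLocus_anti w rj.1.2.2.le
    exact ((isFraction_coord w _ _).mono hsub).div ((isFraction_coord w _ _).mono hsub)
      fun A hA => hA _ rj.1.2.2
  · exact isFraction_frame w n le_rfl _ _

lemma exists_polynomial_fillUnipotent (w : Fin n → Fin k) (r s : Fin k) :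
    ∃ R : MvPolynomial (CellIndex w) ℂ, ∀ y, MvPolynomial.eval y R = fillUnipotent w y r s := by
  by_cases h : s < r ∧ s ∈ Set.range w
  · refine ⟨.X (.inr ⟨(r, s), h⟩), fun y => ?_⟩
    rw [fillUnipotent, Matrix.add_apply, Matrix.one_apply_ne h.1.ne', lowerPart_apply_of_mem _ h]
    simp
  · refine ⟨.C ((1 : Matrix (Fin k) (Fin k) ℂ) r s), fun y => ?_⟩
    rw [fillUnipotent, Matrix.add_apply, lowerPart_apply_of_not_mem _ h]
    simp

lemma exists_polynomial_fillPattern (w : Fin n → Fin k) (r : Fin k) (j : Fin n) :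
    ∃ R : MvPolynomial (CellIndex w) ℂ, ∀ y, MvPolynomial.eval y R = fillPattern w y r j := by
  by_cases hr : r = w j
  · subst hr
    exact ⟨1, fun y => by simp [fillPattern_self]⟩
  · by_cases h : IsStar w r j
    · exact ⟨.X (.inl ⟨(r, j), h⟩), fun y => by simp [fillPattern_of_isStar y h]⟩
    · exact ⟨0, fun y => by simp [fillPattern_of_not_isStar y hr h]⟩

lemma exists_polynomial_evalMatrix (w : Fin n → Fin k) (P : MvPolynomial (Fin k × Fin n) ℂ) :
    ∃ R : MvPolynomial (CellIndex w) ℂ,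
      ∀ y, MvPolynomial.eval y R = evalMatrix (cellMatrix w y) P := by
  choose RU hU using exists_polynomial_fillUnipotent w
  choose RB hB using exists_polynomial_fillPattern w
  refine ⟨MvPolynomial.bind₁ (fun rj => ∑ s, RU rj.1 s * RB s rj.2) P, fun y => ?_⟩
  unfold evalMatrix
  induction P using MvPolynomial.induction_on with
  | C c => simp
  | add P Q hP hQ => simp [hP, hQ]
  | mul_X P i hP => simp [hP, hU, hB, cellMatrix, Matrix.mul_apply]

/-! ### Strata are affine spaces -/

lemma isLocallyClosed_stratum (w : Fin n → Fin k) : IsLocallyClosed (stratum w) := by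
  choose O hO h using fun j r => (isFraction_coord w j r).exists_isOpen
  -- Inside `pivotOpen w`, the stratum is cut out by the vanishing of all coordinates with keys
  -- above the pivot's; `O j r` describes nonvanishing only there.
  refine ⟨pivotOpen w, (⋃ (j : Fin n) (r : Fin k) (_ : key w j (w j) < key w j r), O j r)ᶜ,
    isOpen_pivotOpen w, (isOpen_iUnion fun j => isOpen_iUnion fun r =>
      isOpen_iUnion fun _ => hO j r).isClosed_compl, ?_⟩
  have hmem : ∀ p ∈ pivotOpen w, ∀ j r, p ∈ O j r ↔ coord w (repMatrix p) j r ≠ 0 :=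
    fun p hp j r => h j r p (pivotLocus_anti w j.2.le hp)
  ext p
  simp only [Set.mem_inter_iff, Set.mem_compl_iff, Set.mem_iUnion, not_exists]
  constructor
  · intro hp
    have hpo := stratum_subset_pivotOpen w hp
    refine ⟨hpo, fun j r hlt hO => ?_⟩
    exact absurd ((mem_stratum_iff.1 hp j).2 r ((hmem p hpo j r).1 hO)) (not_le.2 hlt)
  · rintro ⟨hpo, hp⟩
    refine mem_stratum_iff.2 fun j => ⟨hpo j j.2, fun r hr => ?_⟩
    by_contra hlt
    exact hp j r (not_le.1 hlt) ((hmem p hpo j r).2 hr)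

lemma eval_ofMatrix {P : MvPolynomial (Fin k × Fin n) ℂ} {d : Fin n → ℕ}
    (hP : IsMultihomogeneous P d) {A : Matrix (Fin k) (Fin n) ℂ} (hA : ∀ j, A.col j ≠ 0)
    {s : Fin n → ℂˣ} (hs : repMatrix (ofMatrix A hA) = A * Matrix.diagonal fun j => (s j : ℂ)) :
    (ofMatrix A hA).eval P = (∏ j, (s j : ℂ) ^ d j) * evalMatrix A P := by
  rw [eval_eq_evalMatrix, hs, evalMatrix_mul_diagonal hP]

lemma eval_rename_affSpace {ι : Type*} {d : ℕ} (σ : ι → Fin d) (x : AffSpace d)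
    (R : MvPolynomial ι ℂ) :
    MvPolynomial.eval x (MvPolynomial.rename σ R) = MvPolynomial.eval (fun i => x (σ i)) R :=
  MvPolynomial.eval_rename σ _ R

/-- The coordinates on a stratum, as a homeomorphism for the Zariski topologies. -/
noncomputable def cellHomeomorph (w : Fin n → Fin k) {d : ℕ} (σ : CellIndex w ≃ Fin d) :
    stratum w ≃ₜ AffSpace d where
  toFun p := fun i => cellCoord w (repMatrix p.1) (σ.symm i)
  invFun x := ⟨_, ofMatrix_cellMatrix_mem w fun i => x (σ i)⟩
  left_inv p := by
    obtain ⟨t, ht⟩ := (mem_stratum_iff_factors.1 p.2).exists_eq_cellMatrix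
    have hy : (fun i => cellCoord w (repMatrix p.1) (σ.symm (σ i))) =
        cellCoord w (repMatrix p.1) := funext fun i => by rw [σ.symm_apply_apply]
    rw [← hy] at ht
    exact Subtype.ext ((ofMatrix_eq_of_mul_diagonal (cellMatrix_col_ne_zero w _)
      (repMatrix_col_ne_zero p.1) ht).trans (ofMatrix_repMatrix p.1))
  right_inv x := by
    obtain ⟨s, hs⟩ := repMatrix_ofMatrix (cellMatrix_col_ne_zero w fun i => x (σ i))
    funext i
    simp only [hs]
    rw [cellCoord_cellMatrix_mul_diagonal w _ fun j => (s j).ne_zero, Equiv.apply_symm_apply]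
  continuous_toFun := by
    refine continuous_generateFrom_iff.2 ?_
    rintro _ ⟨P, rfl⟩
    -- A polynomial in the coordinates is a fraction of multidegree 0, so its nonvanishing locus is
    -- cut out by its numerator.
    obtain ⟨O, hO, h⟩ := (IsFraction.aeval (fun i => isFraction_cellCoord w (σ.symm i))
      P).exists_isOpen
    refine ⟨O, hO, ?_⟩
    ext p
    exact h p.1 (stratum_subset_pivotOpen w p.2)
  continuous_invFun := by
    refine Continuous.subtype_mk (continuous_generateFrom_iff.2 ?_) _
    rintro _ ⟨P, e, hP, rfl⟩
    obtain ⟨R, hR⟩ := exists_polynomial_evalMatrix w P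
    refine TopologicalSpace.isOpen_generateFrom_of_mem ⟨MvPolynomial.rename σ R, ?_⟩
    ext x
    obtain ⟨s, hs⟩ := repMatrix_ofMatrix (cellMatrix_col_ne_zero w fun i => x (σ i))
    -- This is the factor by which `P` changes between the chosen representatives and the cell
    -- matrix.
    have h0 : ∏ j, (s j : ℂ) ^ e j ≠ 0 :=
      Finset.prod_ne_zero_iff.2 fun j _ => pow_ne_zero _ (s j).ne_zero
    simp only [Set.mem_preimage, Set.mem_ofPred_eq, eval_ofMatrix hP _ hs, eval_rename_affSpace,
      ← hR]
    rw [mul_ne_zero_iff]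
    exact ⟨fun h => h.2, fun h => ⟨h0, h⟩⟩

lemma isRegularOn_comp_cellHomeomorph (w : Fin n → Fin k) {d : ℕ} (σ : CellIndex w ≃ Fin d)
    {U : Set (AffSpace d)} {f : AffSpace d → ℂ} (hf : AffSpace.IsRegularOn U f) :
    ProjProd.IsRegularOn (cellHomeomorph w σ ⁻¹' U) (f ∘ cellHomeomorph w σ) := by
  intro p hp
  obtain ⟨V, hV, hpV, hVU, P, Q, hPQ⟩ := hf _ hp
  -- The pullback of `P / Q` is a fraction only where the pulled-back `Q` is nonzero; this holds at
  -- all points over `V`.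
  let S : Set (Matrix (Fin k) (Fin n) ℂ) := {A | A ∈ pivotLocus w n ∧
    MvPolynomial.eval (fun i => cellCoord w A (σ.symm i)) Q ≠ 0}
  have hS : S ⊆ pivotLocus w n := fun A hA => hA.1
  have hF := fun R => IsFraction.aeval (fun i => isFraction_cellCoord w (σ.symm i)) R
  obtain ⟨N, D, e, hN, hD, h⟩ := ((hF P).mono hS).div ((hF Q).mono hS) fun A hA => hA.2
  refine ⟨cellHomeomorph w σ ⁻¹' V, hV.preimage (cellHomeomorph w σ).continuous, hpV,
    Set.preimage_mono hVU, N, D, e, hN, hD, fun q hq => ?_⟩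
  have hq' := hPQ _ hq
  have := h (repMatrix q.1) ⟨stratum_subset_pivotOpen w q.2, hq'.1⟩
  exact ⟨this.1, hq'.2.trans this.2⟩

lemma isRegularOn_of_comp_cellHomeomorph (w : Fin n → Fin k) {d : ℕ} (σ : CellIndex w ≃ Fin d)
    {U : Set (AffSpace d)} {f : AffSpace d → ℂ}
    (hf : ProjProd.IsRegularOn (cellHomeomorph w σ ⁻¹' U) (f ∘ cellHomeomorph w σ)) :
    AffSpace.IsRegularOn U f := by
  intro x hx
  obtain ⟨V, hV, hxV, hVU, P, Q, e, hP, hQ, hPQ⟩ := hf ((cellHomeomorph w σ).symm x) (by simpa)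
  obtain ⟨R, hR⟩ := exists_polynomial_evalMatrix w P
  obtain ⟨T, hT⟩ := exists_polynomial_evalMatrix w Q
  refine ⟨(cellHomeomorph w σ).symm ⁻¹' V, hV.preimage (cellHomeomorph w σ).symm.continuous, hxV,
    fun y hy => by simpa using hVU hy, MvPolynomial.rename σ R, MvPolynomial.rename σ T,
    fun y hy => ?_⟩
  obtain ⟨s, hs⟩ := repMatrix_ofMatrix (cellMatrix_col_ne_zero w fun i => y (σ i))
  have h0 : ∏ j, (s j : ℂ) ^ e j ≠ 0 :=
    Finset.prod_ne_zero_iff.2 fun j _ => pow_ne_zero _ (s j).ne_zero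
  have hy' := hPQ _ hy
  have hval : ((cellHomeomorph w σ).symm y).1 =
    ofMatrix _ (cellMatrix_col_ne_zero w fun i => y (σ i)) := rfl
  -- Numerator and denominator have the same multidegree, so the scaling factors of the
  -- representatives cancel.
  rw [Function.comp_apply, Homeomorph.apply_symm_apply, hval, eval_ofMatrix hP _ hs,
    eval_ofMatrix hQ _ hs, mul_div_mul_left _ _ h0, ← hR, ← hT] at hy'
  rw [eval_rename_affSpace, eval_rename_affSpace]
  exact ⟨(mul_ne_zero_iff.1 hy'.1).2, hy'.2⟩

lemma isAffineSpaceOfDim_stratum (w : Fin n → Fin k) :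
    IsAffineSpaceOfDim (stratum w) (numStars w + dimUnipotent w) := by
  let σ := Finite.equivFinOfCardEq (card_cellIndex w)
  exact ⟨isLocallyClosed_stratum w, cellHomeomorph w σ, fun U _ f =>
    ⟨isRegularOn_comp_cellHomeomorph w σ, isRegularOn_of_comp_cellHomeomorph w σ⟩⟩

end LineConfig

theorem theorem3p2 (k n : ℕ) (hk : 0 < k) (hkn : k ≤ n) :
    (∀ w : Fin n → Fin k,
      LineConfig.IsAffineSpaceOfDim (LineConfig.stratum w)
        (LineConfig.numStars w + LineConfig.dimUnipotent w)) ∧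
    (LineConfig.IsDisjointUnion Set.univ
        (fun w : Fin n → Fin k => LineConfig.stratum w) Set.univ ∧
      LineConfig.IsDisjointUnion {w : Fin n → Fin k | LineConfig.IsFubini w}
        (fun w : Fin n → Fin k => LineConfig.stratum w) (LineConfig.spanningConfigs k n)) ∧
    (∃ (m : ℕ) (Z : Fin (m + 1) → Set (LineConfig.ProjProd k n)),
      LineConfig.IsAffinePaving (fun w : Fin n → Fin k => LineConfig.stratum w) Z ∧
      ∃ i : Fin (m + 1), LineConfig.spanningConfigs k n = Set.univ \ Z i) :=
  ⟨LineConfig.isAffineSpaceOfDim_stratum,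
    ⟨LineConfig.isDisjointUnion_stratum_univ, LineConfig.isDisjointUnion_stratum_isFubini hk⟩,
    LineConfig.exists_isAffinePaving hk fun w => ⟨_, LineConfig.isAffineSpaceOfDim_stratum w⟩⟩
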